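/- Let $K$ be a field of characteristic $0$ and let $\mathfrak g=\bigoplus_{p\in\mathbb Z}\mathfrak g_p$ be a finite-dimensional $\mathbb Z$-graded Lie algebra over $K$ (so $[\mathfrak g_p,\mathfrak g_q]\subseteq\mathfrak g_{p+q}$). Put $\mathfrak m=\bigoplus_{p<0}\mathfrak g_p$ and $\mathfrak g_+=\bigoplus_{p\ge 0}\mathfrak g_p$, let $\mathfrak n$ be the maximal nilpotent ideal of $\mathfrak g$, and let $\rho:\mathfrak g_0\to\mathfrak{gl}_K(\mathfrak m)$ be the restriction to $\mathfrak m$ of the adjoint representation, $\rho(A)(X)=[A,X]$. Say that - $\mathfrak g$ is almost effective if $\{X\in\mathfrak g_+\mid [X,\mathfrak m]=\{0\}\}=\{0\}$; - $\mathfrak g$ is decomposable if the semisimple and the nilpotent component (in the Jordan–Chevalley decomposition in $\mathfrak{gl}_K(\mathfrak g)$) of each inner derivation of $\mathfrak g$ are inner derivations; - $\mathfrak g$ is of reductive type if $\mathfrak n\cap\mathfrak g_0=\{0\}$. A representation (or module) is called semisimple if each invariant subspace has an invariant complement. Assume that $\mathfrak g$ is almost effective. Then the following are equivalent: (i) $\mathfrak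 g$ is decomposable and of reductive type; (ii) the representation $\rho:\mathfrak g_0\to\mathfrak{gl}_K(\mathfrak m)$ is semisimple; (iii) $\mathfrak g$ is a semisimple $\operatorname{ad}_{\mathfrak g}(\mathfrak g_0)$-module. -/

import Mathlib

/-- A Lie module is semisimple (completely reducible) if every submodule has a complementary
submodule. The zero module is semisimple. -/
def IsSemisimpleLieModule (K 𝔤 M : Type*) [CommRing K] [LieRing 𝔤] [LieAlgebra K 𝔤]
    [AddCommGroup M] [Module K M] [LieRingModule 𝔤 M] [LieModule K 𝔤 M] : Prop :=
  ComplementedLattice (LieSubmodule K 𝔤 M)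

/-- The maximal nilpotent ideal of a (finite dimensional) Lie algebra: the sum of all the ideals
that are nilpotent as Lie algebras.
(Mathlib's `LieAlgebra.maxNilpotentIdeal` is a different, in general smaller, ideal: it is built
from the ideals on which the whole Lie algebra acts nilpotently.) -/
def nilradicalIdeal (K 𝔤 : Type*) [CommRing K] [LieRing 𝔤] [LieAlgebra K 𝔤] : LieIdeal K 𝔤 :=
  sSup {I : LieIdeal K 𝔤 | LieRing.IsNilpotent I}

section Decomposable

attribute [local instance 100] LieRing.ofAssociativeRing

/-- `S` and `N` are the semisimple and the nilpotent component of the endomorphism `A`. In finite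
dimension over a field of characteristic zero such a pair exists and is unique. -/
structure IsJordanChevalley {K V : Type*} [Field K] [AddCommGroup V] [Module K V]
    (A S N : Module.End K V) : Prop where
  add_eq : S + N = A
  commute : Commute S N
  semisimple : S.IsSemisimple
  nilpotent : IsNilpotent N

/-- A Lie algebra of endomorphisms of `V` is decomposable in `V` if it contains the semisimple and
the nilpotent component of each of its elements. -/
def IsDecomposableIn {K V : Type*} [Field K] [AddCommGroup V] [Module K V]
    (𝔤 : LieSubalgebra K (Module.End K V)) : Prop :=
  ∀ A ∈ 𝔤, ∃ S ∈ 𝔤, ∃ N ∈ 𝔤, IsJordanChevalley A S N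

/-- A Lie algebra is decomposable if the semisimple and the nilpotent component of each inner
derivation are inner derivations, that is, if `ad(𝔤)` is decomposable in `𝔤`. -/
def IsDecomposableLieAlgebra (K 𝔤 : Type*) [Field K] [LieRing 𝔤] [LieAlgebra K 𝔤] : Prop :=
  IsDecomposableIn (LieAlgebra.ad K 𝔤).range

end Decomposable

section Graded

variable {K 𝔤 : Type*} [Field K] [LieRing 𝔤] [LieAlgebra K 𝔤]

/-- The structure subalgebra `𝔤₀` of a graded Lie algebra. -/
def structureSubalgebra (𝒜 : ℤ → Submodule K 𝔤) [GradedLieAlgebra 𝒜] : LieSubalgebra K 𝔤 where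
  toSubmodule := 𝒜 0
  lie_mem' := fun {x y} hx hy => by
    simpa using SetLike.GradedBracket.bracket_mem (ℒ := 𝒜) (i := 0) (j := 0)
      (gi := x) (gj := y) hx hy

/-- `𝔪`, the sum of the components of negative degree, as a `𝔤₀`-submodule of `𝔤` (for the
restriction of the adjoint representation). -/
def negativePart (𝒜 : ℤ → Submodule K 𝔤) [GradedLieAlgebra 𝒜] :
    LieSubmodule K (structureSubalgebra 𝒜) 𝔤 where
  toSubmodule := ⨆ p : {p : ℤ // p < 0}, 𝒜 p
  lie_mem := fun {x y} hy => by
    change ⁅(x : 𝔤), y⁆ ∈ ⨆ p : {p : ℤ // p < 0}, 𝒜 p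
    change y ∈ ⨆ p : {p : ℤ // p < 0}, 𝒜 p at hy
    induction hy using Submodule.iSup_induction' with
    | mem p z hz =>
      have h := SetLike.GradedBracket.bracket_mem (ℒ := 𝒜) (i := 0) (j := p) x.2 hz
      rw [zero_add] at h
      exact Submodule.mem_iSup_of_mem p h
    | zero => simp
    | add a b _ _ ha hb => rw [lie_add]; exact add_mem ha hb

/-- `𝔤₊`, the sum of the components of nonnegative degree. -/
def nonnegativePart (𝒜 : ℤ → Submodule K 𝔤) : Submodule K 𝔤 :=
  ⨆ p : {p : ℤ // 0 ≤ p}, 𝒜 p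

/-- Almost effective: an element of `𝔤₊` that commutes with all of `𝔪` is zero. -/
def IsAlmostEffective (𝒜 : ℤ → Submodule K 𝔤) [GradedLieAlgebra 𝒜] : Prop :=
  ∀ x ∈ nonnegativePart 𝒜, (∀ y ∈ negativePart 𝒜, ⁅x, y⁆ = 0) → x = 0

/-- Reductive type: the maximal nilpotent ideal meets `𝔤₀` in zero. -/
def IsOfReductiveType (𝒜 : ℤ → Submodule K 𝔤) : Prop :=
  (nilradicalIdeal K 𝔤).toSubmodule ⊓ 𝒜 0 = ⊥

end Graded

/-! ### Jordan–Chevalley decomposition and intertwining maps. -/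

open Module

/-! Everything passes through (iii). Write rad for the solvable radical. Three classical tools are
proved on the way: `LieModule.isSemisimple_of_radical` (a module is completely reducible if the
radical acts on it centrally and semisimply), Levi's theorem, and the abstract Jordan decomposition.
Almost effectiveness makes 𝔤₀ faithful on 𝔪, and it makes a degree-zero derivation vanishing on 𝔪
vanish.

(iii) → (ii) is restriction to a submodule. For (ii) → (iii), [𝔤₀, rad 𝔤₀] acts nilpotently on every
module, hence trivially on the semisimple faithful module 𝔪, so rad 𝔤₀ is central and acts
semisimply on 𝔪. For z in rad 𝔤₀ the nilpotent component of ad z is a degree-zero derivation that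
vanishes on 𝔪, so it is zero and the criterion above applies to 𝔤.

(i) → (iii): an ad-nilpotent element of 𝔤₀ that is Killing-orthogonal to 𝔤₀ is orthogonal to all of
𝔤, so it lies in 𝔫 ∩ 𝔤₀ = 0. This applies to [𝔤₀, rad 𝔤₀], so rad 𝔤₀ is central. It applies again to
the degree-zero element representing the nilpotent component of ad z, which decomposability makes
inner.

(iii) → (i): 𝔫 ∩ 𝔤₀ acts nilpotently, hence trivially, hence is zero. For decomposability put Z =
rad 𝔤 ∩ 𝔤₀, which is central in 𝔤₀ and ad-semisimple. Since rad 𝔤 is graded and homogeneous elements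
of nonzero degree are ad-nilpotent, rad 𝔤 = Z + 𝔫. The centralizer 𝔠 of Z satisfies 𝔤 = 𝔠 + 𝔫. With
a Levi subalgebra of 𝔠, each x becomes s + z + n, and the Jordan decomposition s = a + b gives x =
(a + z) + (b + n). Here a + z is ad-semisimple and normalizes the ad-nilpotent subalgebra Kb + 𝔫.
Conjugating by exponentials makes the two summands commute modulo the centre, which yields the
decomposition of ad x. -/

theorem Commute.aeval_right {K A : Type*} [Field K] [Ring A] [Algebra K A] {a b : A}
    (h : Commute a b) (p : Polynomial K) : Commute a (Polynomial.aeval b p) :=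
  Algebra.commute_of_mem_adjoin_singleton_of_commute (Polynomial.aeval_mem_adjoin_singleton K b) h

theorem LinearMap.map_aeval_apply {K V W : Type*} [Field K]
    [AddCommGroup V] [Module K V] [AddCommGroup W] [Module K W]
    {A : Module.End K V} {B : Module.End K W} {f : V →ₗ[K] W} (hf : ∀ v, f (A v) = B (f v))
    (p : Polynomial K) (v : V) :
    f (Polynomial.aeval A p v) = Polynomial.aeval B p (f v) := by
  induction p using Polynomial.induction_on' with
  | add p q hp hq => simp [hp, hq]
  | monomial n a =>
    simp only [Polynomial.aeval_monomial, Module.End.mul_apply, Module.algebraMap_end_apply,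
      map_smul]
    congr 1
    induction n with
    | zero => simp
    | succ n ih => rw [pow_succ', Module.End.mul_apply, hf, ih, pow_succ', Module.End.mul_apply]

/-- The two components of a Jordan–Chevalley decomposition are simultaneous polynomials in the
endomorphisms `A` and `B`. -/
theorem IsJordanChevalley.exists_aeval {K V W : Type*} [Field K] [PerfectField K]
    [AddCommGroup V] [Module K V] [FiniteDimensional K V]
    [AddCommGroup W] [Module K W] [FiniteDimensional K W]
    {A S N : Module.End K V} {B S' N' : Module.End K W}
    (h : IsJordanChevalley A S N) (h' : IsJordanChevalley B S' N') :
    ∃ p : Polynomial K, Polynomial.aeval A p = S ∧ Polynomial.aeval B p = S' := by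
  -- Decomposing A ⊕ B on V × W gives one polynomial for both blocks; uniqueness identifies the
  -- blocks with S and S'.
  obtain ⟨n, hn, s, hs, hnn, hss, hadd⟩ := Module.End.exists_isNilpotent_isSemisimple (K := K) (f := (A.prodMap B : Module.End K (V × W)))
  rw [Algebra.adjoin_singleton_eq_range_aeval] at hs
  obtain ⟨p, hp⟩ := hs
  replace hp : Polynomial.aeval (A.prodMap B : Module.End K (V × W)) p = s := hp
  subst hp
  have key : ∀ q : Polynomial K, Polynomial.aeval (A.prodMap B) q =
      (Polynomial.aeval A q).prodMap (Polynomial.aeval B q) := by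
    intro q
    have := Polynomial.aeval_algHom_apply (LinearMap.prodMapAlgHom K V W) (A, B) q
    have h2 : Polynomial.aeval (A, B) q = (Polynomial.aeval A q, Polynomial.aeval B q) :=
      Polynomial.aeval_prod_apply (A, B) q
    rw [h2] at this
    exact this
  have hsq := hss.minpoly_squarefree
  have hz := minpoly.aeval K (Polynomial.aeval (A.prodMap B) p)
  set m := minpoly K (Polynomial.aeval (A.prodMap B) p) with hm
  rw [← Polynomial.aeval_comp, key] at hz
  have hzA : Polynomial.aeval (Polynomial.aeval A p) m = 0 := by
    rw [← Polynomial.aeval_comp]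
    ext v
    simpa using congrArg Prod.fst (LinearMap.congr_fun hz (v, 0))
  have hzB : Polynomial.aeval (Polynomial.aeval B p) m = 0 := by
    rw [← Polynomial.aeval_comp]
    ext v
    simpa using congrArg Prod.snd (LinearMap.congr_fun hz (0, v))
  have hsA := Module.End.isSemisimple_of_squarefree_aeval_eq_zero hsq hzA
  have hsB := Module.End.isSemisimple_of_squarefree_aeval_eq_zero hsq hzB
  have hn' : n = (A - Polynomial.aeval A p).prodMap (B - Polynomial.aeval B p) := by
    rw [eq_sub_of_add_eq hadd.symm, key]
    ext <;> simp
  obtain ⟨k, hk⟩ := hnn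
  have hpow : ∀ j : ℕ, n ^ j =
      ((A - Polynomial.aeval A p) ^ j).prodMap ((B - Polynomial.aeval B p) ^ j) := by
    intro j
    rw [hn']
    exact (map_pow (LinearMap.prodMapAlgHom K V W)
      (A - Polynomial.aeval A p, B - Polynomial.aeval B p) j).symm
  rw [hpow] at hk
  have hnA : IsNilpotent (A - Polynomial.aeval A p) :=
    ⟨k, by ext v; simpa using congrArg Prod.fst (LinearMap.congr_fun hk (v, 0))⟩
  have hnB : IsNilpotent (B - Polynomial.aeval B p) :=
    ⟨k, by ext v; simpa using congrArg Prod.snd (LinearMap.congr_fun hk (0, v))⟩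
  have cA : Commute (A - Polynomial.aeval A p) (Polynomial.aeval A p) :=
    ((Commute.refl A).aeval_right p).sub_left (Commute.refl _)
  have cB : Commute (B - Polynomial.aeval B p) (Polynomial.aeval B p) :=
    ((Commute.refl B).aeval_right p).sub_left (Commute.refl _)
  refine ⟨p, ?_, ?_⟩
  · exact (Module.End.isNilpotent_isSemisimple_unique hnA hsA h.nilpotent h.semisimple cA
      h.commute.symm (by rw [sub_add_cancel, add_comm, h.add_eq])).2
  · exact (Module.End.isNilpotent_isSemisimple_unique hnB hsB h'.nilpotent h'.semisimple cB
      h'.commute.symm (by rw [sub_add_cancel, add_comm, h'.add_eq])).2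

/-- The semisimple components are the same polynomial in A and in B, and an intertwiner of A and B
intertwines polynomials in them. -/
theorem IsJordanChevalley.semisimple_comp {K V W : Type*} [Field K] [PerfectField K]
    [AddCommGroup V] [Module K V] [FiniteDimensional K V]
    [AddCommGroup W] [Module K W] [FiniteDimensional K W]
    {A S N : Module.End K V} {B S' N' : Module.End K W}
    (h : IsJordanChevalley A S N) (h' : IsJordanChevalley B S' N')
    {f : V →ₗ[K] W} (hf : ∀ v, f (A v) = B (f v)) (v : V) : f (S v) = S' (f v) := by
  obtain ⟨p, rfl, rfl⟩ := h.exists_aeval h'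
  exact LinearMap.map_aeval_apply hf p v

theorem IsJordanChevalley.nilpotent_comp {K V W : Type*} [Field K] [PerfectField K]
    [AddCommGroup V] [Module K V] [FiniteDimensional K V]
    [AddCommGroup W] [Module K W] [FiniteDimensional K W]
    {A S N : Module.End K V} {B S' N' : Module.End K W}
    (h : IsJordanChevalley A S N) (h' : IsJordanChevalley B S' N')
    {f : V →ₗ[K] W} (hf : ∀ v, f (A v) = B (f v)) (v : V) : f (N v) = N' (f v) := by
  have h1 : N = A - S := by rw [← h.add_eq, add_sub_cancel_left]
  have h2 : N' = B - S' := by rw [← h'.add_eq, add_sub_cancel_left]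
  simp [h1, h2, hf, h.semisimple_comp h' hf]

theorem IsJordanChevalley.exists_mem_adjoin {K V : Type*} [Field K] [PerfectField K]
    [AddCommGroup V] [Module K V] [FiniteDimensional K V] (A : Module.End K V) :
    ∃ S ∈ Algebra.adjoin K {A}, ∃ N ∈ Algebra.adjoin K {A}, IsJordanChevalley A S N := by
  obtain ⟨n, hn, s, hs, hnn, hss, hadd⟩ := A.exists_isNilpotent_isSemisimple
  exact ⟨s, hs, n, hn, by rw [hadd, add_comm],
    Algebra.commute_of_mem_adjoin_singleton_of_commute hn
      (Algebra.commute_of_mem_adjoin_self hs).symm, hss, hnn⟩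

section Ad

attribute [local instance 100] LieRing.ofAssociativeRing

theorem IsJordanChevalley.ad {K V : Type*} [Field K] [PerfectField K]
    [AddCommGroup V] [Module K V] [FiniteDimensional K V] {A S N : Module.End K V}
    (h : IsJordanChevalley A S N) :
    IsJordanChevalley (LieAlgebra.ad K (Module.End K V) A) (LieAlgebra.ad K (Module.End K V) S)
      (LieAlgebra.ad K (Module.End K V) N) where
  add_eq := by rw [← map_add, h.add_eq]
  commute := LieAlgebra.commute_ad_of_commute h.commute
  semisimple := LieAlgebra.ad_isSemisimple_of_isSemisimple h.semisimple
  nilpotent := LieAlgebra.ad_nilpotent_of_nilpotent h.nilpotent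

/-- The semisimple component of a derivation is a derivation. -/
theorem IsJordanChevalley.semisimple_leibniz {K L : Type*} [Field K] [PerfectField K]
    [LieRing L] [LieAlgebra K L] [FiniteDimensional K L] {D S N : Module.End K L}
    (h : IsJordanChevalley D S N) (hD : ∀ x y, D ⁅x, y⁆ = ⁅D x, y⁆ + ⁅x, D y⁆) (x y : L) :
    S ⁅x, y⁆ = ⁅S x, y⁆ + ⁅x, S y⁆ := by
  -- The Leibniz rule for D says exactly that `ad` intertwines D with `ad D`.
  have key := h.semisimple_comp h.ad (f := (LieAlgebra.ad K L : L →ₗ[K] Module.End K L)) ?_ x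
  · have := LinearMap.congr_fun key y
    simp [LieRing.of_associative_ring_bracket] at this
    rw [this]; abel
  · intro v
    ext w
    simp [LieRing.of_associative_ring_bracket, hD]

theorem IsJordanChevalley.nilpotent_leibniz {K L : Type*} [Field K] [PerfectField K]
    [LieRing L] [LieAlgebra K L] [FiniteDimensional K L] {D S N : Module.End K L}
    (h : IsJordanChevalley D S N) (hD : ∀ x y, D ⁅x, y⁆ = ⁅D x, y⁆ + ⁅x, D y⁆) (x y : L) :
    N ⁅x, y⁆ = ⁅N x, y⁆ + ⁅x, N y⁆ := by
  have h1 : N = D - S := by rw [← h.add_eq, add_sub_cancel_left]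
  simp [h1, hD, h.semisimple_leibniz hD]
  abel

end Ad

/-! ### Nilpotency from vanishing traces. -/

/-- The Fitting projection onto the part where C is invertible has the form C p(C). Its trace is its
rank, so in characteristic zero it vanishes. -/
theorem Module.End.isNilpotent_of_forall_trace_mul_aeval {K V : Type*} [Field K] [CharZero K]
    [AddCommGroup V] [Module K V] [FiniteDimensional K V] {C : Module.End K V}
    (h : ∀ p : Polynomial K, LinearMap.trace K V (C * Polynomial.aeval C p) = 0) :
    IsNilpotent C := by
  have hm0 : minpoly K C ≠ 0 := minpoly.ne_zero_of_finite K C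
  obtain ⟨m, q, hq, hmq⟩ : ∃ (m : ℕ) (q : Polynomial K), ¬ Polynomial.X ∣ q ∧
      minpoly K C = Polynomial.X ^ m * q := by
    obtain ⟨q, h1, h2⟩ := (FiniteMultiplicity.of_prime_left Polynomial.prime_X hm0).exists_eq_pow_mul_and_not_dvd
    exact ⟨_, q, h2, h1⟩
  -- The exponent m + 1 instead of m makes the projection e divisible by X even when m = 0.
  have hcop : IsCoprime (Polynomial.X ^ (m + 1) : Polynomial K) q :=
    ((Polynomial.prime_X.coprime_iff_not_dvd).2 hq).pow_left
  obtain ⟨a, b, hab⟩ := hcop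
  have hmin : Polynomial.aeval C (Polynomial.X ^ m * q) = 0 := by rw [← hmq, minpoly.aeval]
  set e := Polynomial.aeval C (a * Polynomial.X ^ (m + 1)) with he
  have hidem : IsIdempotentElem e := by
    have : (a * Polynomial.X ^ (m + 1)) * (a * Polynomial.X ^ (m + 1)) =
        a * Polynomial.X ^ (m + 1) - (a * b * Polynomial.X) * (Polynomial.X ^ m * q) := by
      linear_combination (a * Polynomial.X ^ (m + 1)) * hab
    rw [IsIdempotentElem, he, ← map_mul, this, map_sub, map_mul _ (a * b * _), hmin, mul_zero,
      sub_zero]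
  have htr : LinearMap.trace K V e = 0 := by
    rw [he, show a * Polynomial.X ^ (m + 1) = Polynomial.X * (a * Polynomial.X ^ m) by ring,
      map_mul, Polynomial.aeval_X]
    exact h _
  have he0 : e = 0 := (LinearMap.IsIdempotentElem.trace_eq_zero_iff hidem).1 htr
  refine ⟨m, ?_⟩
  have h1 := congrArg (Polynomial.aeval C) hab
  rw [map_add, ← he, he0, zero_add, map_one] at h1
  calc C ^ m = C ^ m * 1 := (mul_one _).symm
    _ = Polynomial.aeval C (b * (Polynomial.X ^ m * q)) := by
      rw [← h1, ← Polynomial.aeval_X_pow (R := K) C, ← map_mul]; congr 1; ring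
    _ = 0 := by rw [map_mul, hmin, mul_zero]

/-- An endomorphism commuting with all the factors of a sum of commutators that contains it is
nilpotent. -/
theorem Module.End.isNilpotent_of_commute_of_mem_span {K V : Type*} [Field K] [CharZero K]
    [AddCommGroup V] [Module K V] [FiniteDimensional K V] {C B : Module.End K V}
    {s : Set (Module.End K V)} (hC : ∀ a ∈ s, Commute C a)
    (hB : B ∈ Submodule.span K {z | ∃ a ∈ s, ∃ b : Module.End K V, z = a * b - b * a})
    (hBC : IsNilpotent (B - C)) (hcomm : Commute B C) : IsNilpotent C := by
  refine Module.End.isNilpotent_of_forall_trace_mul_aeval fun p ↦ ?_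
  -- Since a commutes with p(C), the traces of a b p(C) and b a p(C) agree.
  have h1 : LinearMap.trace K V (B * Polynomial.aeval C p) = 0 := by
    clear hBC hcomm
    induction hB using Submodule.span_induction with
    | mem x hx =>
      obtain ⟨a, ha, b, rfl⟩ := hx
      have hc : Commute (Polynomial.aeval C p) a :=
        ((hC a ha).symm.aeval_right p).symm
      rw [sub_mul, map_sub, sub_eq_zero, mul_assoc, mul_assoc, LinearMap.trace_mul_comm,
        mul_assoc, hc.eq]
    | zero => simp
    | add x y _ _ hx hy => rw [add_mul, map_add, hx, hy, add_zero]
    | smul c x _ hx => rw [smul_mul_assoc, map_smul, hx, smul_zero]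
  have h2 : IsNilpotent ((B - C) * Polynomial.aeval C p) :=
    ((hcomm.sub_left (Commute.refl C)).aeval_right p).isNilpotent_mul_right hBC
  have h3 : LinearMap.trace K V ((B - C) * Polynomial.aeval C p) = 0 :=
    (LinearMap.isNilpotent_trace_of_isNilpotent h2).eq_zero
  rw [sub_mul, map_sub, h1, zero_sub, neg_eq_zero] at h3
  exact h3

/-! ### Ideals acting nilpotently; the action of [L, I] for solvable I. -/

section Representations

attribute [local instance 100] LieRing.ofAssociativeRing

open LieModule LieAlgebra

variable {K L V : Type*} [Field K] [LieRing L] [LieAlgebra K L]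
  [AddCommGroup V] [Module K V] [LieRingModule L V] [LieModule K L V]

theorem LieIdeal.exists_lcs_eq_bot (I : LieIdeal K L) [LieModule.IsNilpotent I V] :
    ∃ p, I.lcs V p = ⊥ := by
  obtain ⟨p, hp⟩ := LieModule.IsNilpotent.nilpotent K I V
  refine ⟨p, ?_⟩
  rw [← LieSubmodule.toSubmodule_eq_bot, LieIdeal.coe_lcs_eq, hp]
  rfl

theorem LieIdeal.isNilpotent_of_forall_lcs (I : LieIdeal K L) [LieModule.IsNilpotent I V]
    {T : Module.End K V} (hT : ∀ k, ∀ v ∈ I.lcs V k, T v ∈ I.lcs V (k + 1)) : _root_.IsNilpotent T := by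
  obtain ⟨p, hp⟩ := I.exists_lcs_eq_bot (V := V)
  have h : ∀ k v, (T ^ k) v ∈ I.lcs V k := by
    intro k
    induction k with
    | zero => intro v; simp
    | succ k ih => intro v; rw [pow_succ', Module.End.mul_apply]; exact hT k _ (ih v)
  refine ⟨p, ?_⟩
  ext v
  simpa [hp] using h p v

/-- An element of an ideal acting nilpotently, composed with any action, is nilpotent. -/
theorem LieIdeal.isNilpotent_toEnd_mul (I : LieIdeal K L) [LieModule.IsNilpotent I V]
    {a : L} (ha : a ∈ I) (b : L) : _root_.IsNilpotent (toEnd K L V a * toEnd K L V b) := by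
  refine I.isNilpotent_of_forall_lcs fun k v hv ↦ ?_
  rw [LieIdeal.lcs_succ]
  exact LieSubmodule.lie_mem_lie ha (LieSubmodule.lie_mem _ hv)

/-- On the successive quotients of the filtration `I.lcs V` the element a acts as zero, so a + b
acts there as b. A power of a + b therefore lowers the filtration strictly. -/
theorem LieIdeal.isNilpotent_toEnd_add (I : LieIdeal K L) [LieModule.IsNilpotent I V]
    {a b : L} (ha : a ∈ I) (hb : _root_.IsNilpotent (toEnd K L V b)) :
    _root_.IsNilpotent (toEnd K L V (a + b)) := by
  obtain ⟨q, hq⟩ := hb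
  have key : ∀ j k, ∀ v ∈ I.lcs V k,
      ((toEnd K L V (a + b)) ^ j) v - ((toEnd K L V b) ^ j) v ∈ I.lcs V (k + 1) := by
    intro j
    induction j with
    | zero => intro k v _; simp
    | succ j ih =>
      intro k v hv
      have h1 : ((toEnd K L V b) ^ j) v ∈ I.lcs V k := by
        clear ih
        induction j with
        | zero => simpa using hv
        | succ j ih =>
          rw [pow_succ', Module.End.mul_apply]
          exact LieSubmodule.lie_mem _ ih
      have h2 := (I.lcs V (k + 1)).lie_mem (x := a + b) (ih k v hv)
      have h3 : ⁅a, ((toEnd K L V b) ^ j) v⁆ ∈ I.lcs V (k + 1) := by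
        rw [LieIdeal.lcs_succ]
        exact LieSubmodule.lie_mem_lie ha h1
      have := add_mem h2 h3
      simp only [pow_succ', Module.End.mul_apply, toEnd_apply_apply]
      convert this using 1
      simp only [lie_sub, add_lie]
      abel
  have h : _root_.IsNilpotent ((toEnd K L V (a + b)) ^ q) :=
    I.isNilpotent_of_forall_lcs fun k v hv ↦ by simpa [hq] using key q k v hv
  obtain ⟨m, hm⟩ := h
  exact ⟨q * m, by rw [pow_mul, hm]⟩

/-- The submodule of vectors killed by an ideal. -/
def LieIdeal.killedBy (V : Type*) [AddCommGroup V] [Module K V] [LieRingModule L V]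
    [LieModule K L V] (J : LieIdeal K L) : LieSubmodule K L V where
  carrier := {v | ∀ x ∈ J, ⁅x, v⁆ = 0}
  add_mem' hv hw x hx := by rw [lie_add, hv x hx, hw x hx, add_zero]
  zero_mem' x _ := lie_zero x
  smul_mem' c v hv x hx := by rw [lie_smul, hv x hx, smul_zero]
  lie_mem {y v} hv x hx := by
    rw [leibniz_lie, hv x hx, lie_zero, add_zero]
    exact hv _ (lie_mem_left K L J x y hx)

theorem LieIdeal.isNilpotent_of_forall_toEnd [FiniteDimensional K V] (J : LieIdeal K L)
    (h : ∀ x ∈ J, _root_.IsNilpotent (toEnd K L V x)) : LieModule.IsNilpotent J V :=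
  (LieModule.isNilpotent_iff_forall' (R := K)).2 fun x ↦ h x x.2

theorem LieIdeal.killedBy_ne_bot [FiniteDimensional K V] [Nontrivial V] (J : LieIdeal K L)
    (h : ∀ x ∈ J, _root_.IsNilpotent (toEnd K L V x)) : J.killedBy V ≠ ⊥ := by
  have := J.isNilpotent_of_forall_toEnd h
  have := LieModule.nontrivial_max_triv_of_isNilpotent K J V
  obtain ⟨⟨v, hv⟩, hv0⟩ := exists_ne (0 : maxTrivSubmodule K J V)
  intro hbot
  have hmem : v ∈ J.killedBy V := fun x hx ↦ hv ⟨x, hx⟩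
  rw [hbot, LieSubmodule.mem_bot] at hmem
  exact hv0 (Subtype.ext hmem)

theorem LieSubmodule.isNilpotent_toEnd_of_quotient (W : LieSubmodule K L V) {x : L}
    (h1 : _root_.IsNilpotent (toEnd K L W x)) (h2 : _root_.IsNilpotent (toEnd K L (V ⧸ W) x)) :
    _root_.IsNilpotent (toEnd K L V x) := by
  obtain ⟨k, hk⟩ := h1
  obtain ⟨l, hl⟩ := h2
  have hq : ∀ j v, ((toEnd K L (V ⧸ W) x) ^ j) (LieSubmodule.Quotient.mk' W v) =
      LieSubmodule.Quotient.mk' W (((toEnd K L V x) ^ j) v) := by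
    intro j
    induction j with
    | zero => intro v; simp
    | succ j ih =>
      intro v
      rw [pow_succ', Module.End.mul_apply, ih, pow_succ', Module.End.mul_apply]
      simp only [toEnd_apply_apply, LieModuleHom.map_lie]
  refine ⟨k + l, ?_⟩
  ext v
  rw [pow_add, Module.End.mul_apply]
  have hm : ((toEnd K L V x) ^ l) v ∈ W := by
    rw [← LieSubmodule.Quotient.mk_eq_zero, ← hq, hl]; simp
  have := LieSubmodule.coe_toEnd_pow (N := W) (x := x) (y := ⟨_, hm⟩) (n := k)
  rw [hk] at this
  simpa using this.symm

/-- By Engel the vectors killed by J form a nonzero submodule, which irreducibility makes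
everything. -/
theorem LieModule.isNilpotent_toEnd_of_irreducible [FiniteDimensional K V] (J : LieIdeal K L)
    (hirr : LieModule.IsIrreducible K L V) (h : ∀ x ∈ J, _root_.IsNilpotent (toEnd K L V x))
    {x : L} (hx : x ∈ J) : toEnd K L V x = 0 := by
  have := LieModule.nontrivial_of_isIrreducible K L V
  have htop : J.killedBy V = ⊤ :=
    (IsSimpleOrder.eq_bot_or_eq_top _).resolve_left (J.killedBy_ne_bot h)
  ext v
  exact (htop ▸ LieSubmodule.mem_top v : v ∈ J.killedBy V) x hx

theorem LieModule.toEnd_mem_span (A B : LieIdeal K L) {z : L} (hz : z ∈ ⁅A, B⁆) :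
    toEnd K L V z ∈ Submodule.span K
      {t : Module.End K V | ∃ a ∈ toEnd K L V '' B, ∃ b, t = a * b - b * a} := by
  rw [← LieSubmodule.mem_toSubmodule, LieSubmodule.lieIdeal_oper_eq_linear_span'] at hz
  induction hz using Submodule.span_induction with
  | mem z hz =>
    obtain ⟨y, _, w, hw, rfl⟩ := hz
    refine Submodule.subset_span ⟨_, ⟨w, hw, rfl⟩, -toEnd K L V y, ?_⟩
    rw [LieHom.map_lie, LieRing.of_associative_ring_bracket, mul_neg, neg_mul, sub_neg_eq_add,
      add_comm, ← sub_eq_add_neg]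
  | zero => simp
  | add y w _ _ hy hw => rw [map_add]; exact add_mem hy hw
  | smul c y _ hy => rw [map_smul]; exact Submodule.smul_mem _ _ hy

/-- Descent along the derived series of I, from its zero term back to I. The engine `nil` is the
trace criterion: if the action of [A, B] commutes with that of B, then [A, B] acts nilpotently,
hence by zero. -/
theorem LieModule.toEnd_eq_zero_of_irreducible [CharZero K] [FiniteDimensional K V]
    (hirr : LieModule.IsIrreducible K L V) (I : LieIdeal K L) [hI : IsSolvable I] {x : L}
    (hx : x ∈ ⁅(⊤ : LieIdeal K L), I⁆) : toEnd K L V x = 0 := by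
  have nil : ∀ A B : LieIdeal K L, (∀ z ∈ ⁅A, B⁆, ∀ b ∈ B, toEnd K L V ⁅z, b⁆ = 0) →
      ∀ z ∈ ⁅A, B⁆, toEnd K L V z = 0 := by
    intro A B hAB
    refine fun z hz ↦ LieModule.isNilpotent_toEnd_of_irreducible _ hirr (fun z hz ↦ ?_) hz
    refine Module.End.isNilpotent_of_commute_of_mem_span (B := toEnd K L V z)
      (s := toEnd K L V '' B) ?_ (toEnd_mem_span A B hz) (by simp) (Commute.refl _)
    rintro _ ⟨b, hb, rfl⟩
    have := hAB z hz b hb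
    rw [LieHom.map_lie, LieRing.of_associative_ring_bracket, sub_eq_zero] at this
    exact this
  obtain ⟨n, hn⟩ := IsSolvable.solvable K I
  rw [LieIdeal.derivedSeries_eq_bot_iff] at hn
  have main : ∀ j k, j + k = n →
      ∀ z ∈ ⁅(⊤ : LieIdeal K L), derivedSeriesOfIdeal K L k I⁆, toEnd K L V z = 0 := by
    intro j
    induction j with
    | zero =>
      intro k hk z hz
      obtain rfl : k = n := by omega
      rw [hn, LieSubmodule.lie_bot, LieSubmodule.mem_bot] at hz
      rw [hz, map_zero]
    | succ j ih =>
      intro k hk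
      have h1 := ih (k + 1) (by omega)
      -- Brackets of the (k+1)-st derived ideal with the k-th lie in [L, I⁽ᵏ⁺¹⁾], which acts by
      -- zero; so I⁽ᵏ⁺¹⁾ = [I⁽ᵏ⁾, I⁽ᵏ⁾] itself acts by zero.
      have h2 : ∀ z ∈ derivedSeriesOfIdeal K L (k + 1) I, toEnd K L V z = 0 := by
        rw [derivedSeriesOfIdeal_succ]
        refine nil _ _ fun z hz b _ ↦ ?_
        rw [← lie_skew, map_neg, h1, neg_zero]
        rw [derivedSeriesOfIdeal_succ]
        exact LieSubmodule.lie_mem_lie (LieSubmodule.mem_top b) hz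
      refine nil _ _ fun z hz b hb ↦ h2 _ ?_
      rw [derivedSeriesOfIdeal_succ]
      exact LieSubmodule.lie_mem_lie (LieSubmodule.lie_le_right _ _ hz) hb
  exact main n 0 (by omega) x hx

theorem LieModule.isNilpotent_toEnd_of_mem_lie_solvable_aux [CharZero K]
    (I : LieIdeal K L) [hI : IsSolvable I] {x : L} (hx : x ∈ ⁅(⊤ : LieIdeal K L), I⁆) (n : ℕ) :
    ∀ (V : Type _) [AddCommGroup V] [Module K V] [LieRingModule L V] [LieModule K L V]
      [FiniteDimensional K V], finrank K V = n → _root_.IsNilpotent (toEnd K L V x) := by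
  induction n using Nat.strong_induction_on with
  | _ n ih =>
    intro V _ _ _ _ _ hn
    by_cases hV : Nontrivial V
    · by_cases h : ∀ N : LieSubmodule K L V, N ≠ ⊥ → N = ⊤
      · rw [LieModule.toEnd_eq_zero_of_irreducible (LieModule.IsIrreducible.mk h) I hx]
        exact _root_.IsNilpotent.zero
      · push Not at h
        obtain ⟨N, h1, h2⟩ := h
        refine N.isNilpotent_toEnd_of_quotient (ih _ ?_ N rfl) (ih _ ?_ (V ⧸ N) rfl)
        · rw [← hn]
          exact Submodule.finrank_lt (by simpa [lt_top_iff_ne_top] using h2)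
        · rw [← hn]
          have := Submodule.finrank_quotient_add_finrank N.toSubmodule
          have h3 : finrank K N.toSubmodule ≠ 0 := by
            rw [Ne, Submodule.finrank_eq_zero]; simpa using h1
          change finrank K (V ⧸ N.toSubmodule) < _
          omega
    · rw [not_nontrivial_iff_subsingleton] at hV
      exact ⟨1, Subsingleton.elim _ _⟩

/-- In characteristic zero `[L, I]`, for a solvable ideal `I` of `L`, acts nilpotently on every
finite dimensional representation. -/
theorem LieModule.isNilpotent_lie_solvable [CharZero K] [FiniteDimensional K V]
    (I : LieIdeal K L) [IsSolvable I] :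
    LieModule.IsNilpotent (⁅(⊤ : LieIdeal K L), I⁆ : LieIdeal K L) V :=
  LieIdeal.isNilpotent_of_forall_toEnd _ fun _ hx ↦
    LieModule.isNilpotent_toEnd_of_mem_lie_solvable_aux I hx _ V rfl

end Representations

/-! ### The radical under surjections. -/

section Radical

attribute [local instance 100] LieRing.ofAssociativeRing

open LieModule LieAlgebra

variable {K L L' : Type*} [Field K] [LieRing L] [LieAlgebra K L] [LieRing L'] [LieAlgebra K L']

/-- An ideal that maps into a solvable ideal with solvable kernel is solvable. -/
theorem LieIdeal.isSolvable_of_le_comap (f : L →ₗ⁅K⁆ L') {J A : LieIdeal K L} {J' : LieIdeal K L'}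
    [hJ' : IsSolvable J'] [hA : IsSolvable A] (h : J ≤ J'.comap f) (hk : J ⊓ f.ker ≤ A) :
    IsSolvable J := by
  obtain ⟨k, hk'⟩ := IsSolvable.solvable K J'
  obtain ⟨l, hl⟩ := IsSolvable.solvable K A
  rw [LieIdeal.derivedSeries_eq_bot_iff] at hk' hl
  have h1 : ∀ j, derivedSeriesOfIdeal K L j J ≤ (derivedSeriesOfIdeal K L' j J').comap f := by
    intro j
    induction j with
    | zero => simpa using h
    | succ j ih =>
      rw [derivedSeriesOfIdeal_succ, derivedSeriesOfIdeal_succ]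
      exact (LieSubmodule.mono_lie ih ih).trans (LieIdeal.comap_bracket_le f)
  have h2 : derivedSeriesOfIdeal K L k J ≤ A := by
    refine le_trans (le_inf (derivedSeriesOfIdeal_le_self J k) ?_) hk
    intro x hx
    have := h1 k hx
    rw [hk', LieIdeal.mem_comap, LieSubmodule.mem_bot] at this
    exact LieHom.mem_ker.2 this
  refine IsSolvable.mk (R := K) (k := l + k) ((LieIdeal.derivedSeries_eq_bot_iff J _).2 ?_)
  rw [derivedSeriesOfIdeal_add, eq_bot_iff, ← hl]
  exact derivedSeriesOfIdeal_le h2 le_rfl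

theorem LieAlgebra.mem_radical_of_mem {J : LieIdeal K L} [FiniteDimensional K L]
    (hJ : IsSolvable J) {x : L} (hx : x ∈ J) : x ∈ radical K L :=
  (LieIdeal.solvable_iff_le_radical K L J).1 hJ hx

theorem LieAlgebra.map_mem_radical [FiniteDimensional K L] [FiniteDimensional K L']
    {f : L →ₗ⁅K⁆ L'} (hf : Function.Surjective f) {x : L} (hx : x ∈ radical K L) :
    f x ∈ radical K L' := by
  have : IsSolvable ((radical K L).map f) := by
    obtain ⟨k, hk⟩ := IsSolvable.solvable K (radical K L)
    rw [LieIdeal.derivedSeries_eq_bot_iff] at hk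
    refine IsSolvable.mk (R := K) (k := k) ((LieIdeal.derivedSeries_eq_bot_iff _ _).2 ?_)
    have : ∀ j, derivedSeriesOfIdeal K L' j ((radical K L).map f) ≤
        (derivedSeriesOfIdeal K L j (radical K L)).map f := by
      intro j
      induction j with
      | zero => simp
      | succ j ih =>
        rw [derivedSeriesOfIdeal_succ, derivedSeriesOfIdeal_succ]
        rw [LieIdeal.map_bracket_eq f hf]
        exact LieSubmodule.mono_lie ih ih
    rw [eq_bot_iff]
    refine (this k).trans ?_
    rw [hk]
    simp
  exact mem_radical_of_mem this (LieIdeal.mem_map hx)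

theorem LieAlgebra.mem_radical_of_surjective [FiniteDimensional K L] [FiniteDimensional K L']
    {f : L →ₗ⁅K⁆ L'} (hf : Function.Surjective f) [IsSolvable f.ker] {x : L} :
    x ∈ radical K L ↔ f x ∈ radical K L' := by
  refine ⟨map_mem_radical hf, fun hx ↦ ?_⟩
  refine mem_radical_of_mem (J := (radical K L').comap f)
    (LieIdeal.isSolvable_of_le_comap f (A := f.ker) le_rfl inf_le_right) ?_
  rwa [LieIdeal.mem_comap]

/-- The quotient by an ideal, as a morphism of Lie algebras. -/
def LieIdeal.quotientHom (I : LieIdeal K L) : L →ₗ⁅K⁆ L ⧸ I where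
  __ := (LieSubmodule.Quotient.mk' I : L →ₗ[K] L ⧸ I)
  map_lie' {x y} := LieSubmodule.Quotient.mk_bracket I x y

theorem LieIdeal.quotientHom_surjective (I : LieIdeal K L) : Function.Surjective I.quotientHom :=
  LieSubmodule.Quotient.surjective_mk' I

theorem LieIdeal.quotientHom_eq_zero (I : LieIdeal K L) {x : L} : I.quotientHom x = 0 ↔ x ∈ I :=
  LieSubmodule.Quotient.mk_eq_zero I

theorem LieIdeal.quotientHom_ker (I : LieIdeal K L) : I.quotientHom.ker = I := by
  ext x
  rw [LieHom.mem_ker, I.quotientHom_eq_zero]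

instance LieIdeal.quotient_finiteDimensional [FiniteDimensional K L] (I : LieIdeal K L) :
    FiniteDimensional K (L ⧸ I) :=
  Module.Finite.of_surjective (I.quotientHom : L →ₗ[K] L ⧸ I) I.quotientHom_surjective

instance LieAlgebra.hasTrivialRadical_quotient_radical [FiniteDimensional K L] :
    HasTrivialRadical K (L ⧸ radical K L) := by
  refine ⟨?_⟩
  rw [LieSubmodule.eq_bot_iff]
  intro x hx
  obtain ⟨y, rfl⟩ := (radical K L).quotientHom_surjective x
  have : IsSolvable (radical K L).quotientHom.ker := by
    rw [LieIdeal.quotientHom_ker]; infer_instance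
  rw [← mem_radical_of_surjective (radical K L).quotientHom_surjective] at hx
  exact (LieIdeal.quotientHom_eq_zero _).2 hx

/-- In the semisimple quotient by the radical, the image of ker f has a Killing complement. Its
preimage J still maps onto L' and meets ker f inside the radical, so a solvable ideal of L' pulls
back in J to a solvable ideal, which f kills. -/
theorem LieAlgebra.hasTrivialRadical_of_surjective [CharZero K] [FiniteDimensional K L]
    [FiniteDimensional K L'] {f : L →ₗ⁅K⁆ L'} (hf : Function.Surjective f)
    (hker : radical K L ≤ f.ker) : HasTrivialRadical K L' := by
  set π := (radical K L).quotientHom with hπ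
  have hπs : Function.Surjective π := LieIdeal.quotientHom_surjective _
  have hπ0 : ∀ x, π x = 0 ↔ x ∈ radical K L := fun x ↦ LieIdeal.quotientHom_eq_zero _
  set Q := f.ker.map π with hQ
  have hc := LieIdeal.isCompl_killingCompl Q
  set J := Q.killingCompl.comap π with hJ
  have hsup : ∀ x, ∃ j ∈ J, f x = f j := by
    intro x
    have hx : π x ∈ Q ⊔ Q.killingCompl := by rw [hc.sup_eq_top]; trivial
    obtain ⟨a, ha, b, hb, hab⟩ := (LieSubmodule.mem_sup _ _ _).1 hx
    obtain ⟨⟨k, hk⟩, hka⟩ := LieIdeal.mem_map_of_surjective hπs ha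
    simp only at hka
    refine ⟨x - k, ?_, ?_⟩
    · rw [hJ, LieIdeal.mem_comap, map_sub, hka, ← hab, add_sub_cancel_left]
      exact hb
    · rw [map_sub, LieHom.mem_ker.1 hk, sub_zero]
  have hinf : J ⊓ f.ker ≤ radical K L := by
    rintro x ⟨h1, h2⟩
    rw [← hπ0]
    have : π x ∈ Q ⊓ Q.killingCompl := ⟨LieIdeal.mem_map h2, h1⟩
    rwa [hc.inf_eq_bot, LieSubmodule.mem_bot] at this
  refine ⟨?_⟩
  rw [LieSubmodule.eq_bot_iff]
  intro y hy
  obtain ⟨x, rfl⟩ := hf y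
  obtain ⟨j, hj, hxj⟩ := hsup x
  rw [hxj] at hy ⊢
  have hsol : IsSolvable (J ⊓ (radical K L').comap f : LieIdeal K L) :=
    LieIdeal.isSolvable_of_le_comap f (J' := radical K L') (A := radical K L) inf_le_right
      ((inf_le_inf_right _ inf_le_left).trans hinf)
  exact LieHom.mem_ker.1 (hker (mem_radical_of_mem hsol ⟨hj, hy⟩))

end Radical

/-! ### Trace forms and the Casimir operator. -/

section Casimir

attribute [local instance 100] LieRing.ofAssociativeRing

open LieModule LieAlgebra

variable {K L V : Type*} [Field K] [LieRing L] [LieAlgebra K L]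
  [AddCommGroup V] [Module K V] [LieRingModule L V] [LieModule K L V]

theorem LieAlgebra.isNilpotent_of_faithful [FiniteDimensional K L] (M : Type*) [AddCommGroup M]
    [Module K M] [LieRingModule L M] [LieModule K L M]
    (hfaith : ∀ x : L, toEnd K L M x = 0 → x = 0) [LieModule.IsNilpotent L M] :
    LieRing.IsNilpotent L := by
  rw [LieAlgebra.isNilpotent_iff_forall (R := K)]
  intro x
  obtain ⟨k, hk⟩ := LieAlgebra.ad_nilpotent_of_nilpotent (R := K)
    (LieModule.isNilpotent_toEnd_of_isNilpotent K L M x)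
  refine ⟨k, ?_⟩
  ext y
  have : ∀ j, toEnd K L M (((ad K L x) ^ j) y) =
      ((ad K (Module.End K M) (toEnd K L M x)) ^ j) (toEnd K L M y) := by
    intro j
    induction j with
    | zero => simp
    | succ j ih =>
      rw [pow_succ', Module.End.mul_apply, ad_apply, LieHom.map_lie, ih, pow_succ',
        Module.End.mul_apply, ad_apply]
  refine hfaith _ ?_
  rw [this, hk, LinearMap.zero_apply]

/-- Cartan's criterion: on the kernel of the form the trace form vanishes, so its derived algebra
acts nilpotently and, by faithfulness, is nilpotent. The kernel is then a solvable ideal, hence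
zero. -/
theorem LieAlgebra.traceForm_nondegenerate [CharZero K] [FiniteDimensional K L]
    [FiniteDimensional K V] [HasTrivialRadical K L]
    (hfaith : ∀ x : L, toEnd K L V x = 0 → x = 0) : (traceForm K L V).Nondegenerate := by
  refine (LieModule.traceForm_isSymm K L V).isRefl.nondegenerate_iff_separatingLeft.mpr ?_
  set I : LieIdeal K L := LieAlgebra.InvariantForm.orthogonal (traceForm K L V)
    (traceForm_lieInvariant K L V) ⊤ with hI
  have htr : traceForm K I V = 0 := by
    ext x y
    have := (LieAlgebra.InvariantForm.mem_orthogonal _ _ _ _).1 y.2 (x : L) trivial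
    exact this
  have hnil := LieModule.isNilpotent_derivedSeries_of_traceForm_eq_zero htr
  have hnil' : LieRing.IsNilpotent (derivedSeries K I 1) :=
    LieAlgebra.isNilpotent_of_faithful (K := K) V fun x hx ↦
      Subtype.ext (Subtype.ext (hfaith (x : I) hx))
  have hsol : IsSolvable I := by
    obtain ⟨k, hk⟩ := IsSolvable.solvable K (derivedSeries K I 1)
    rw [LieIdeal.derivedSeries_eq_bot_iff, ← derivedSeriesOfIdeal_add] at hk
    exact IsSolvable.mk hk
  have hbot : I = ⊥ := HasTrivialRadical.eq_bot_of_isSolvable I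
  intro x hx
  have : x ∈ I := (LieAlgebra.InvariantForm.mem_orthogonal _ _ _ _).2 fun y _ ↦ by
    rw [traceForm_comm]; exact hx y
  rwa [hbot, LieSubmodule.mem_bot] at this

/-- The Casimir operator of a faithful representation. -/
theorem LieAlgebra.exists_casimir [CharZero K] [FiniteDimensional K L]
    [FiniteDimensional K V] [HasTrivialRadical K L] [Nontrivial L]
    (hfaith : ∀ x : L, toEnd K L V x = 0 → x = 0) :
    ∃ T : Module.End K V, ¬ _root_.IsNilpotent T ∧ (∀ (x : L) (v : V), T ⁅x, v⁆ = ⁅x, T v⁆) ∧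
      ∀ v, T v ∈ ⁅(⊤ : LieIdeal K L), (⊤ : LieSubmodule K L V)⁆ := by
  have hnd := LieAlgebra.traceForm_nondegenerate hfaith
  set τ := traceForm K L V with hτ
  have hsymm : LinearMap.BilinForm.IsSymm τ := ⟨fun x y ↦ traceForm_comm K L V x y⟩
  set b := Module.finBasis K L with hb
  set d := LinearMap.BilinForm.dualBasis τ hnd b with hd
  have hexp1 : ∀ x, x = ∑ j, τ x (d j) • b j := by
    intro x
    conv_lhs => rw [← b.sum_repr x]
    refine Finset.sum_congr rfl fun j _ ↦ ?_
    congr 1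
    have := LinearMap.BilinForm.dualBasis_repr_apply hnd d x j
    rwa [hd, LinearMap.BilinForm.dualBasis_dualBasis hnd hsymm b] at this
  have hexp2 : ∀ x, x = ∑ j, τ x (b j) • d j := by
    intro x
    conv_lhs => rw [← d.sum_repr x]
    refine Finset.sum_congr rfl fun j _ ↦ ?_
    rw [hd, LinearMap.BilinForm.dualBasis_repr_apply hnd b x j]
  refine ⟨∑ i, toEnd K L V (b i) * toEnd K L V (d i), ?_, ?_, ?_⟩
  -- Each summand has trace 1, so the trace of the operator is dim L, nonzero in characteristic
  -- zero.
  · intro hnil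
    have h0 := (LinearMap.isNilpotent_trace_of_isNilpotent hnil).eq_zero
    have h1 : ∀ i, LinearMap.trace K V (toEnd K L V (b i) * toEnd K L V (d i)) = 1 := by
      intro i
      have := LinearMap.BilinForm.apply_dualBasis_right hnd hsymm b i i
      rw [if_pos rfl] at this
      exact this
    rw [map_sum, Finset.sum_congr rfl fun i _ ↦ h1 i] at h0
    simp at h0
    exact (Module.finrank_pos (R := K) (M := L)).ne' h0
  · intro x v
    have e1 : ∀ i, ⁅x, b i⁆ = ∑ j, τ ⁅x, b i⁆ (d j) • b j := fun i ↦ hexp1 _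
    have e2 : ∀ i, ⁅x, d i⁆ = ∑ j, τ ⁅x, d i⁆ (b j) • d j := fun i ↦ hexp2 _
    have e3 : ∀ i j, τ ⁅x, d j⁆ (b i) = - τ ⁅x, b i⁆ (d j) := by
      intro i j
      rw [hτ, traceForm_apply_lie_apply', traceForm_comm]
    have s1 : ∑ i, ⁅⁅x, b i⁆, ⁅d i, v⁆⁆ = ∑ i, ∑ j, τ ⁅x, b i⁆ (d j) • ⁅b j, ⁅d i, v⁆⁆ := by
      refine Finset.sum_congr rfl fun i _ ↦ ?_
      conv_lhs => rw [e1 i]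
      simp only [_root_.sum_lie, smul_lie]
    have s2 : ∑ i, ⁅b i, ⁅⁅x, d i⁆, v⁆⁆ = ∑ i, ∑ j, τ ⁅x, d i⁆ (b j) • ⁅b i, ⁅d j, v⁆⁆ := by
      refine Finset.sum_congr rfl fun i _ ↦ ?_
      conv_lhs => rw [e2 i]
      simp only [_root_.sum_lie, _root_.lie_sum, smul_lie, lie_smul]
    -- Invariance of the form makes the matrices of ad x in the two dual bases negative transposes
    -- of each other.
    have s3 : ∑ i, ⁅⁅x, b i⁆, ⁅d i, v⁆⁆ + ∑ i, ⁅b i, ⁅⁅x, d i⁆, v⁆⁆ = 0 := by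
      rw [s1, s2, Finset.sum_comm, ← Finset.sum_add_distrib]
      refine Finset.sum_eq_zero fun i _ ↦ ?_
      rw [← Finset.sum_add_distrib]
      refine Finset.sum_eq_zero fun j _ ↦ ?_
      rw [e3, neg_smul, add_neg_cancel]
    simp only [LinearMap.sum_apply, Module.End.mul_apply, toEnd_apply_apply, _root_.lie_sum]
    rw [← sub_eq_zero, ← neg_eq_zero, neg_sub, ← Finset.sum_sub_distrib, ← s3,
      ← Finset.sum_add_distrib]
    refine Finset.sum_congr rfl fun i _ ↦ ?_
    rw [leibniz_lie x (b i), leibniz_lie x (d i), lie_add]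
    abel
  · intro v
    rw [LinearMap.sum_apply]
    exact Submodule.sum_mem _ fun i _ ↦ LieSubmodule.lie_mem_lie trivial trivial

end Casimir

/-! ### Invariants and complete reducibility. -/

section Invariants

attribute [local instance 100] LieRing.ofAssociativeRing

open LieModule LieAlgebra

variable {K L V : Type*} [Field K] [LieRing L] [LieAlgebra K L]
  [AddCommGroup V] [Module K V] [LieRingModule L V] [LieModule K L V]

theorem LieAlgebra.exists_casimir_of_radical_trivial [CharZero K] [FiniteDimensional K L]
    [FiniteDimensional K V] (hrad : ∀ x ∈ radical K L, toEnd K L V x = 0)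
    (hnt : ∃ x, toEnd K L V x ≠ 0) :
    ∃ T : Module.End K V, ¬ _root_.IsNilpotent T ∧ (∀ (x : L) (v : V), T ⁅x, v⁆ = ⁅x, T v⁆) ∧
      ∀ v, T v ∈ ⁅(⊤ : LieIdeal K L), (⊤ : LieSubmodule K L V)⁆ := by
  set A := (toEnd K L V).range with hA
  have hs : Function.Surjective (toEnd K L V).rangeRestrict :=
    LieHom.surjective_rangeRestrict _
  have : HasTrivialRadical K A := by
    refine hasTrivialRadical_of_surjective (K := K) hs fun x hx ↦ ?_
    rw [LieHom.mem_ker]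
    exact Subtype.ext (hrad x hx)
  have : Nontrivial A := by
    obtain ⟨x, hx⟩ := hnt
    exact ⟨⟨_, ⟨x, rfl⟩⟩, 0, fun h ↦ hx (congrArg Subtype.val h)⟩
  obtain ⟨T, h1, h2, h3⟩ := exists_casimir (K := K) (L := A) (V := V) fun x hx ↦ by
    ext v
    exact LinearMap.congr_fun hx v
  refine ⟨T, h1, fun x v ↦ h2 ⟨_, ⟨x, rfl⟩⟩ v, fun v ↦ ?_⟩
  have h4 := h3 v
  rw [← LieSubmodule.mem_toSubmodule, LieSubmodule.lieIdeal_oper_eq_linear_span'] at h4 ⊢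
  refine Submodule.span_mono ?_ h4
  rintro _ ⟨⟨_, ⟨x, rfl⟩⟩, _, w, _, rfl⟩
  exact ⟨x, trivial, w, trivial, rfl⟩

/-- Fitting decomposition: kernel and range of a high power of T span V, the range lies in LV, and
the kernel N is proper because T is not nilpotent. -/
theorem LieModule.exists_sub_mem_of_equivariant [FiniteDimensional K V] {T : Module.End K V}
    (hT : ¬ _root_.IsNilpotent T) (hc : ∀ (x : L) (v : V), T ⁅x, v⁆ = ⁅x, T v⁆)
    (hr : ∀ v, T v ∈ ⁅(⊤ : LieIdeal K L), (⊤ : LieSubmodule K L V)⁆) :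
    ∃ N : LieSubmodule K L V, N ≠ ⊤ ∧
      ∀ v, ∃ n ∈ N, v - n ∈ ⁅(⊤ : LieIdeal K L), (⊤ : LieSubmodule K L V)⁆ := by
  obtain ⟨k, hk⟩ := Filter.eventually_atTop.1 T.eventually_isCompl_ker_pow_range_pow
  replace hk := hk (k + 1) (by omega)
  have hcp : ∀ (j : ℕ) (x : L) (v : V), (T ^ j) ⁅x, v⁆ = ⁅x, (T ^ j) v⁆ := by
    intro j
    induction j with
    | zero => simp
    | succ j ih => intro x v; rw [pow_succ', Module.End.mul_apply, ih, hc, Module.End.mul_apply]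
  let N : LieSubmodule K L V :=
    { LinearMap.ker (T ^ (k + 1)) with
      lie_mem := fun {x v} (hv : (T ^ (k + 1)) v = 0) ↦
        (show (T ^ (k + 1)) ⁅x, v⁆ = 0 by rw [hcp, hv, lie_zero]) }
  have hN : ∀ v, v ∈ N ↔ (T ^ (k + 1)) v = 0 := fun v ↦ Iff.rfl
  refine ⟨N, fun h ↦ hT ⟨k + 1, ?_⟩, fun v ↦ ?_⟩
  · ext v
    exact (hN v).1 (h ▸ LieSubmodule.mem_top v)
  · have : v ∈ LinearMap.ker (T ^ (k + 1)) ⊔ LinearMap.range (T ^ (k + 1)) := by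
      rw [hk.sup_eq_top]; trivial
    obtain ⟨n, hn, _, ⟨w, rfl⟩, rfl⟩ := Submodule.mem_sup.1 this
    refine ⟨n, hn, ?_⟩
    rw [add_sub_cancel_left, pow_succ', Module.End.mul_apply]
    exact hr _

/-- Induction on the dimension. A nontrivial action supplies an equivariant, non-nilpotent T with
values in LV: a Casimir operator if the radical acts by zero, otherwise a radical element itself.
The Fitting kernel of T is then a smaller module. -/
theorem LieModule.sup_maxTriv_eq_top_aux [CharZero K] [FiniteDimensional K L] (n : ℕ) :
    ∀ (V : Type _) [AddCommGroup V] [Module K V] [LieRingModule L V] [LieModule K L V]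
      [FiniteDimensional K V], finrank K V = n →
      (∀ x ∈ radical K L, (toEnd K L V x).IsSemisimple) →
      (∀ x ∈ radical K L, ∀ (y : L) (v : V), ⁅⁅y, x⁆, v⁆ = 0) →
      ∀ v : V, ∃ w ∈ maxTrivSubmodule K L V,
        v - w ∈ ⁅(⊤ : LieIdeal K L), (⊤ : LieSubmodule K L V)⁆ := by
  induction n using Nat.strong_induction_on with
  | _ n ih =>
    intro V _ _ _ _ _ hn h1 h2 v
    have step : ∀ T : Module.End K V, ¬ _root_.IsNilpotent T →
        (∀ (x : L) (v : V), T ⁅x, v⁆ = ⁅x, T v⁆) →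
        (∀ v, T v ∈ ⁅(⊤ : LieIdeal K L), (⊤ : LieSubmodule K L V)⁆) →
        ∃ w ∈ maxTrivSubmodule K L V,
          v - w ∈ ⁅(⊤ : LieIdeal K L), (⊤ : LieSubmodule K L V)⁆ := by
      intro T hT hc hr
      obtain ⟨N, hN, hv⟩ := LieModule.exists_sub_mem_of_equivariant hT hc hr
      obtain ⟨u, hu, huv⟩ := hv v
      obtain ⟨w, hw, hwu⟩ := ih (finrank K N) (by
          rw [← hn]
          exact Submodule.finrank_lt (by simpa [lt_top_iff_ne_top] using hN)) N rfl
        (fun x hx ↦ (h1 x hx).restrict (p := N.toSubmodule) fun v hv ↦ N.lie_mem hv)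
        (fun x hx y v ↦ Subtype.ext (h2 x hx y v)) ⟨u, hu⟩
      refine ⟨w, fun x ↦ congrArg Subtype.val (hw x), ?_⟩
      have h3 : ((⟨u, hu⟩ - w : N) : V) ∈ ⁅(⊤ : LieIdeal K L), (⊤ : LieSubmodule K L V)⁆ := by
        have := LieSubmodule.mem_map_of_mem (f := N.incl) hwu
        rw [LieSubmodule.map_bracket_eq] at this
        exact LieSubmodule.mono_lie le_rfl le_top this
      have := add_mem huv h3
      convert this using 1
      simp
    by_cases htriv : ∀ x, toEnd K L V x = 0
    · exact ⟨v, fun x ↦ LinearMap.congr_fun (htriv x) v, by simp⟩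
    · push Not at htriv
      by_cases hrad : ∀ x ∈ radical K L, toEnd K L V x = 0
      · obtain ⟨T, hT⟩ := LieAlgebra.exists_casimir_of_radical_trivial hrad htriv
        exact step T hT.1 hT.2.1 hT.2.2
      · push Not at hrad
        obtain ⟨x, hx, hx0⟩ := hrad
        refine step (toEnd K L V x)
          (fun h ↦ hx0 (Module.End.eq_zero_of_isNilpotent_isSemisimple h (h1 x hx)))
          (fun y w ↦ ?_) (fun w ↦ LieSubmodule.lie_mem_lie trivial trivial)
        have := h2 x hx y w
        rw [lie_lie, sub_eq_zero] at this
        exact this.symm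

/-- If the radical acts centrally and by semisimple endomorphisms, then a representation is
generated by its invariants and by `L V`. -/
theorem LieModule.exists_invariant_sub_mem [CharZero K] [FiniteDimensional K L]
    [FiniteDimensional K V] (h1 : ∀ x ∈ radical K L, (toEnd K L V x).IsSemisimple)
    (h2 : ∀ x ∈ radical K L, ∀ (y : L) (v : V), ⁅⁅y, x⁆, v⁆ = 0) (v : V) :
    ∃ w ∈ maxTrivSubmodule K L V,
      v - w ∈ ⁅(⊤ : LieIdeal K L), (⊤ : LieSubmodule K L V)⁆ :=
  LieModule.sup_maxTriv_eq_top_aux _ V rfl h1 h2 v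

/-- The endomorphisms with values in `N` that are scalar on `N`. -/
def LieSubmodule.scalarEnd (N : LieSubmodule K L V) : LieSubmodule K L (Module.End K V) where
  carrier := {φ | (∀ v, φ v ∈ N) ∧ ∃ c : K, ∀ n ∈ N, φ n = c • n}
  add_mem' := by
    rintro φ ψ ⟨h1, c, h2⟩ ⟨h3, d, h4⟩
    exact ⟨fun v ↦ add_mem (h1 v) (h3 v), c + d, fun n hn ↦ by
      rw [LinearMap.add_apply, h2 n hn, h4 n hn, add_smul]⟩
  zero_mem' := ⟨fun _ ↦ zero_mem _, 0, fun n _ ↦ by simp⟩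
  smul_mem' := by
    rintro a φ ⟨h1, c, h2⟩
    exact ⟨fun v ↦ N.smul_mem a (h1 v), a * c, fun n hn ↦ by
      rw [LinearMap.smul_apply, h2 n hn, mul_smul]⟩
  lie_mem := by
    rintro x φ ⟨h1, c, h2⟩
    refine ⟨fun v ↦ ?_, 0, fun n hn ↦ ?_⟩
    · rw [LieHom.lie_apply]
      exact sub_mem (N.lie_mem (h1 v)) (h1 _)
    · rw [LieHom.lie_apply, h2 n hn, h2 _ (N.lie_mem hn), lie_smul, sub_self, zero_smul]

/-- Scalars commute with L, so bracketing destroys the scalar on N. Hence changing an element of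
`N.scalarEnd` modulo brackets keeps its restriction to N. -/
theorem LieSubmodule.lie_scalarEnd_apply (N : LieSubmodule K L V) {φ : N.scalarEnd}
    (hφ : φ ∈ ⁅(⊤ : LieIdeal K L), (⊤ : LieSubmodule K L N.scalarEnd)⁆) {n : V} (hn : n ∈ N) :
    (φ : Module.End K V) n = 0 := by
  rw [← LieSubmodule.mem_toSubmodule, LieSubmodule.lieIdeal_oper_eq_linear_span'] at hφ
  induction hφ using Submodule.span_induction with
  | mem φ h =>
    obtain ⟨x, _, ⟨ψ, h1, c, h2⟩, _, rfl⟩ := h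
    change (⁅x, ψ⁆ : Module.End K V) n = 0
    rw [LieHom.lie_apply, h2 n hn, h2 _ (N.lie_mem hn), lie_smul, sub_self]
  | zero => rfl
  | add φ ψ _ _ h1 h2 =>
    change (φ : Module.End K V) n + (ψ : Module.End K V) n = 0
    rw [h1, h2, add_zero]
  | smul c φ _ h =>
    change c • (φ : Module.End K V) n = 0
    rw [h, smul_zero]

theorem LieModule.toEnd_end_eq_ad (x : L) :
    toEnd K L (Module.End K V) x = LieAlgebra.ad K (Module.End K V) (toEnd K L V x) := by
  ext φ v
  simp [LieRing.of_associative_ring_bracket]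

/-- **Weyl's theorem** for reductive Lie algebras: a representation in which the radical acts
centrally and by semisimple endomorphisms is completely reducible. -/
theorem LieModule.isSemisimple_of_radical [CharZero K] [FiniteDimensional K L]
    [FiniteDimensional K V] (h1 : ∀ x ∈ radical K L, (toEnd K L V x).IsSemisimple)
    (h2 : ∀ x ∈ radical K L, ∀ (y : L) (v : V), ⁅⁅y, x⁆, v⁆ = 0) :
    IsSemisimpleLieModule K L V := by
  refine ⟨fun N ↦ ?_⟩
  obtain ⟨f, hf⟩ := N.toSubmodule.subtype.exists_leftInverse_of_injective (by simp)
  have hfn : ∀ n (hn : n ∈ N), f n = ⟨n, hn⟩ := fun n hn ↦ LinearMap.congr_fun hf ⟨n, hn⟩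
  -- An arbitrary linear projection onto N. Its invariant part ψ agrees with it on N, so ψ is an
  -- equivariant projection and its kernel is the complement sought.
  let π : N.scalarEnd := ⟨N.toSubmodule.subtype ∘ₗ f, fun v ↦ (f v).2, 1, fun n hn ↦ by
    simp [hfn n hn]⟩
  obtain ⟨w, hw, hwπ⟩ := LieModule.exists_invariant_sub_mem (K := K) (L := L) (V := N.scalarEnd)
    (fun x hx ↦ by
      have := LieAlgebra.ad_isSemisimple_of_isSemisimple (h1 x hx)
      rw [← LieModule.toEnd_end_eq_ad] at this
      exact this.restrict (p := N.scalarEnd.toSubmodule) fun v hv ↦ N.scalarEnd.lie_mem hv)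
    (fun x hx y φ ↦ by
      have : toEnd K L V ⁅y, x⁆ = 0 := by ext v; exact h2 x hx y v
      refine Subtype.ext ?_
      change toEnd K L (Module.End K V) ⁅y, x⁆ φ = 0
      rw [LieModule.toEnd_end_eq_ad, this]; simp) π
  set ψ : Module.End K V := w.1 with hψ
  have hψN : ∀ v, ψ v ∈ N := w.2.1
  have hψ1 : ∀ n ∈ N, ψ n = n := by
    intro n hn
    have h3 := N.lie_scalarEnd_apply hwπ hn
    change f n - ψ n = 0 at h3
    rw [hfn n hn, sub_eq_zero] at h3
    exact h3.symm
  have hψc : ∀ (x : L) v, ψ ⁅x, v⁆ = ⁅x, ψ v⁆ := by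
    intro x v
    have h3 : (⁅x, ψ⁆ : Module.End K V) = 0 := congrArg Subtype.val (hw x)
    have h4 := LinearMap.congr_fun h3 v
    rw [LieHom.lie_apply, LinearMap.zero_apply, sub_eq_zero] at h4
    exact h4.symm
  refine ⟨{ LinearMap.ker ψ with
      lie_mem := fun {x v} (hv : ψ v = 0) ↦
        (show ψ ⁅x, v⁆ = 0 by rw [hψc, hv, lie_zero]) }, ?_⟩
  rw [← LieSubmodule.isCompl_toSubmodule, isCompl_iff, Submodule.disjoint_def, codisjoint_iff,
    eq_top_iff]
  refine ⟨fun v hv (hv' : ψ v = 0) ↦ by rw [← hψ1 v hv, hv'], fun v _ ↦ ?_⟩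
  rw [show v = ψ v + (v - ψ v) by abel]
  refine Submodule.add_mem_sup (hψN v) ?_
  change ψ (v - ψ v) = 0
  rw [map_sub, hψ1 _ (hψN v), sub_self]

/-- An ideal that acts nilpotently on a completely reducible representation acts trivially. -/
theorem IsSemisimpleLieModule.toEnd_eq_zero [FiniteDimensional K V]
    (h : IsSemisimpleLieModule K L V) (J : LieIdeal K L)
    (hJ : ∀ x ∈ J, _root_.IsNilpotent (toEnd K L V x)) {x : L} (hx : x ∈ J) (v : V) :
    ⁅x, v⁆ = 0 := by
  obtain ⟨W, hW⟩ := h.exists_isCompl (J.killedBy V)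
  -- A nonzero complement would contain a nonzero vector killed by J, by Engel.
  have hbot : W = ⊥ := by
    by_contra hne
    have : Nontrivial W := (LieSubmodule.nontrivial_iff_ne_bot K L V).2 hne
    refine J.killedBy_ne_bot (V := W) (fun x hx ↦ ?_) ?_
    · obtain ⟨k, hk⟩ := hJ x hx
      refine ⟨k, ?_⟩
      ext w
      rw [LieSubmodule.coe_toEnd_pow, hk]; rfl
    · rw [LieSubmodule.eq_bot_iff]
      intro w hw
      have h1 : (w : V) ∈ J.killedBy V := fun x hx ↦ congrArg Subtype.val (hw x hx)
      have h2 : (w : V) ∈ J.killedBy V ⊓ W := ⟨h1, w.2⟩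
      rw [hW.inf_eq_bot, LieSubmodule.mem_bot] at h2
      exact Subtype.ext h2
  have htop : J.killedBy V = ⊤ := by simpa [hbot] using hW.sup_eq_top
  exact (htop ▸ LieSubmodule.mem_top v : v ∈ J.killedBy V) x hx

/-- A nilpotent equivariant endomorphism preserving all submodules of a completely reducible
representation vanishes. -/
theorem IsSemisimpleLieModule.eq_zero_of_isNilpotent (h : IsSemisimpleLieModule K L V)
    {T : Module.End K V} (hT : _root_.IsNilpotent T)
    (hc : ∀ (x : L) (v : V), T ⁅x, v⁆ = ⁅x, T v⁆)
    (hN : ∀ N : LieSubmodule K L V, ∀ v ∈ N, T v ∈ N) : T = 0 := by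
  let N : LieSubmodule K L V :=
    { LinearMap.ker T with
      lie_mem := fun {x v} (hv : T v = 0) ↦ (show T ⁅x, v⁆ = 0 by rw [hc, hv, lie_zero]) }
  obtain ⟨W, hW⟩ := h.exists_isCompl N
  obtain ⟨k, hk⟩ := hT
  have key : ∀ j, ∀ w ∈ W, (T ^ j) w = 0 → w = 0 := by
    intro j
    induction j with
    | zero => intro w _ hw; simpa using hw
    | succ j ih =>
      intro w hw h0
      rw [pow_succ, Module.End.mul_apply] at h0
      have h1 : T w = 0 := ih _ (hN W w hw) h0
      have h2 : w ∈ N ⊓ W := ⟨h1, hw⟩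
      rwa [hW.inf_eq_bot, LieSubmodule.mem_bot] at h2
  have hbot : W = ⊥ := by
    rw [LieSubmodule.eq_bot_iff]
    exact fun w hw ↦ key k w hw (by rw [hk]; rfl)
  have htop : N = ⊤ := by simpa [hbot] using hW.sup_eq_top
  ext v
  exact (htop ▸ LieSubmodule.mem_top v : v ∈ N)

theorem LieSubmodule.mem_of_mem_adjoin (N : LieSubmodule K L V) {x : L} {T : Module.End K V}
    (hT : T ∈ Algebra.adjoin K {toEnd K L V x}) {v : V} (hv : v ∈ N) : T v ∈ N := by
  induction hT using Algebra.adjoin_induction generalizing v with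
  | mem y hy => rw [Set.mem_singleton_iff.1 hy]; exact N.lie_mem hv
  | algebraMap r => exact N.smul_mem r hv
  | add y z _ _ h1 h2 => exact add_mem (h1 hv) (h2 hv)
  | mul y z _ _ h1 h2 => exact h1 (h2 hv)

/-- An element acting centrally on a completely reducible representation acts by a semisimple
endomorphism. -/
theorem IsSemisimpleLieModule.isSemisimple_toEnd [CharZero K] [FiniteDimensional K V]
    (h : IsSemisimpleLieModule K L V) {x : L} (hx : ∀ (y : L) (v : V), ⁅⁅y, x⁆, v⁆ = 0) :
    (toEnd K L V x).IsSemisimple := by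
  obtain ⟨S, hS, N, hN, hJ⟩ := IsJordanChevalley.exists_mem_adjoin (toEnd K L V x)
  have hN0 : N = 0 := by
    refine h.eq_zero_of_isNilpotent hJ.nilpotent (fun y v ↦ ?_) fun W v hv ↦
      W.mem_of_mem_adjoin hN hv
    have hc : Commute (toEnd K L V y) (toEnd K L V x) := by
      ext v
      have := hx y v
      rw [lie_lie, sub_eq_zero] at this
      exact this
    exact (LinearMap.congr_fun
      (Algebra.commute_of_mem_adjoin_singleton_of_commute hN hc).eq v).symm
  rw [← hJ.add_eq, hN0, add_zero]
  exact hJ.semisimple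

theorem IsSemisimpleLieModule.lie_radical_eq_zero [CharZero K] [FiniteDimensional K L]
    [FiniteDimensional K V] (h : IsSemisimpleLieModule K L V) {x : L} (hx : x ∈ radical K L)
    (y : L) (v : V) : ⁅⁅y, x⁆, v⁆ = 0 := by
  have := LieModule.isNilpotent_lie_solvable (V := V) (radical K L)
  refine h.toEnd_eq_zero ⁅(⊤ : LieIdeal K L), radical K L⁆ (fun z hz ↦ ?_)
    (LieSubmodule.lie_mem_lie trivial hx) v
  exact LieModule.isNilpotent_toEnd_of_isNilpotent K
    (⁅(⊤ : LieIdeal K L), radical K L⁆ : LieIdeal K L) V ⟨z, hz⟩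

end Invariants

/-! ### Levi's theorem and the abstract Jordan decomposition. -/

section Levi

attribute [local instance 100] LieRing.ofAssociativeRing

open LieModule LieAlgebra

variable {K L : Type*} [Field K] [CharZero K] [LieRing L] [LieAlgebra K L] [FiniteDimensional K L]

/-- A Lie algebra with nonzero abelian radical has a proper subalgebra that maps onto the quotient
by the radical. -/
theorem LieAlgebra.exists_subalgebra_of_abelian_radical
    (hab : ∀ x ∈ radical K L, ∀ y ∈ radical K L, ⁅x, y⁆ = 0) (h0 : radical K L ≠ ⊥) :
    ∃ T : LieSubalgebra K L, T ≠ ⊤ ∧ ∀ x, ∃ t ∈ T, x - t ∈ radical K L := by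
  set R : LieSubmodule K L L := radical K L with hR
  let P : LieSubmodule K L (Module.End K L) :=
    { R.toSubmodule.map (ad K L : L →ₗ[K] Module.End K L) with
      lie_mem := by
        rintro x _ ⟨r, hr, rfl⟩
        refine ⟨⁅x, r⁆, R.lie_mem hr, ?_⟩
        ext y
        rw [LieHom.lie_apply]
        simp }
  have hP : ∀ φ : Module.End K L, φ ∈ P ↔ ∃ r ∈ R, ad K L r = φ := fun φ ↦ Iff.rfl
  have hRM : ∀ x ∈ R, ∀ φ : Module.End K L, (∀ v, φ v ∈ R) → ∀ c : K, (∀ n ∈ R, φ n = c • n) →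
      ⁅x, φ⁆ = ad K L (-(c • x)) := by
    intro x hx φ h1 c h2
    ext y
    rw [LieHom.lie_apply, hab x hx _ (h1 y), h2 _ (lie_mem_left K L R x y hx)]
    simp
  set P' : LieSubmodule K L R.scalarEnd := P.comap R.scalarEnd.incl with hP'
  have hPzero : ∀ φ ∈ P, ∀ r ∈ R, φ r = 0 := by
    intro φ hφ r hr
    obtain ⟨s, hs, rfl⟩ := (hP _).1 hφ
    exact hab s hs r hr
  obtain ⟨f, hf⟩ := R.toSubmodule.subtype.exists_leftInverse_of_injective (by simp)
  have hfn : ∀ n (hn : n ∈ R), f n = ⟨n, hn⟩ := fun n hn ↦ LinearMap.congr_fun hf ⟨n, hn⟩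
  let π : R.scalarEnd := ⟨R.toSubmodule.subtype ∘ₗ f, fun v ↦ (f v).2, 1, fun n hn ↦ by
    simp [hfn n hn]⟩
  -- Modulo `P` (the image of R under ad) the radical acts by zero, since [x, φ] = -c · ad x for φ
  -- scalar c on R. Hence the class of a projection onto R has an invariant part.
  have hradQ : ∀ x ∈ radical K L, toEnd K L (R.scalarEnd ⧸ P') x = 0 := by
    intro x hx
    ext q
    obtain ⟨⟨φ, h1, c, h2⟩, rfl⟩ := LieSubmodule.Quotient.surjective_mk' P' q
    rw [toEnd_apply_apply, ← LieModuleHom.map_lie, LinearMap.zero_apply,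
      LieSubmodule.Quotient.mk_eq_zero]
    exact (hP _).2 ⟨_, R.neg_mem (R.smul_mem c hx), (hRM x hx φ h1 c h2).symm⟩
  obtain ⟨w, hw, hwπ⟩ := LieModule.exists_invariant_sub_mem (K := K) (L := L)
    (V := R.scalarEnd ⧸ P') (fun x hx ↦ by rw [hradQ x hx]; exact Module.End.isSemisimple_zero)
    (fun x hx y v ↦ LinearMap.congr_fun (hradQ _ ((radical K L).lie_mem hx)) v)
    (LieSubmodule.Quotient.mk' P' π)
  obtain ⟨φ, rfl⟩ := LieSubmodule.Quotient.surjective_mk' P' w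
  have hφR : ∀ v, (φ : Module.End K L) v ∈ R := φ.2.1
  have hφ1 : ∀ r ∈ R, (φ : Module.End K L) r = r := by
    intro r hr
    rw [← map_sub] at hwπ
    have htop : (⊤ : LieSubmodule K L (R.scalarEnd ⧸ P')) =
        (⊤ : LieSubmodule K L R.scalarEnd).map (LieSubmodule.Quotient.mk' P') := by
      rw [LieModuleHom.map_top, LieSubmodule.Quotient.range_mk']
    rw [htop, ← LieSubmodule.map_bracket_eq] at hwπ
    obtain ⟨ψ, hψ, hψφ⟩ := (LieSubmodule.mem_map _).1 hwπ
    have h1 : (π - φ - ψ : R.scalarEnd) ∈ P' := by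
      rw [← LieSubmodule.Quotient.mk_eq_zero, map_sub, hψφ, sub_self]
    have h2 := hPzero _ h1 r hr
    have h3 := R.lie_scalarEnd_apply hψ hr
    change f r - (φ : Module.End K L) r - (ψ : Module.End K L) r = 0 at h2
    rw [h3, hfn r hr, sub_zero, sub_eq_zero] at h2
    exact h2.symm
  have hφP : ∀ x : L, ⁅x, (φ : Module.End K L)⁆ ∈ P := by
    intro x
    have := hw x
    rw [← LieModuleHom.map_lie, LieSubmodule.Quotient.mk_eq_zero] at this
    exact this
  -- The stabilizer of φ is the natural candidate for the subalgebra.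
  let S : LieSubalgebra K L :=
    { carrier := {x | ⁅x, (φ : Module.End K L)⁆ = 0}
      add_mem' := fun {x y} (hx : _ = _) (hy : _ = _) ↦
        (show ⁅x + y, (φ : Module.End K L)⁆ = 0 by rw [add_lie, hx, hy, add_zero])
      zero_mem' := zero_lie _
      smul_mem' := fun c x (hx : _ = _) ↦
        (show ⁅c • x, (φ : Module.End K L)⁆ = 0 by rw [smul_lie, hx, smul_zero])
      lie_mem' := fun {x y} (hx : _ = _) (hy : _ = _) ↦
        (show ⁅⁅x, y⁆, (φ : Module.End K L)⁆ = 0 by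
          rw [lie_lie, hx, hy, lie_zero, lie_zero, sub_zero]) }
  -- If everything fixes φ, then φ is an equivariant projection onto R and its kernel is a proper
  -- subalgebra that does the job.
  by_cases hS : S = ⊤
  · have hφc : ∀ x y : L, ⁅x, (φ : Module.End K L) y⁆ = (φ : Module.End K L) ⁅x, y⁆ := by
      intro x y
      have h1 : x ∈ S := by rw [hS]; trivial
      have h2 := LinearMap.congr_fun (show ⁅x, (φ : Module.End K L)⁆ = 0 from h1) y
      rwa [LieHom.lie_apply, LinearMap.zero_apply, sub_eq_zero] at h2
    refine ⟨{ LinearMap.ker (φ : Module.End K L) with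
      lie_mem' := fun {x y} _ (hy : _ = _) ↦ (show (φ : Module.End K L) ⁅x, y⁆ = 0 by
        rw [← hφc, hy, lie_zero]) }, fun htop ↦ h0 ?_, fun x ↦ ⟨x - (φ : Module.End K L) x, ?_, ?_⟩⟩
    · rw [LieSubmodule.eq_bot_iff]
      intro r hr
      have h1 : r ∈ (⊤ : LieSubalgebra K L) := trivial
      rw [← htop] at h1
      rw [← hφ1 r hr]
      exact h1
    · change (φ : Module.End K L) (x - (φ : Module.End K L) x) = 0
      rw [map_sub, hφ1 _ (hφR x), sub_self]
    · rw [sub_sub_cancel]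
      exact hφR x
  · refine ⟨S, hS, fun x ↦ ?_⟩
    obtain ⟨r, hr, hrx⟩ := (hP _).1 (hφP x)
    -- [x, φ] = ad r and [r, φ] = -ad r, so x + r fixes φ.
    refine ⟨x + r, ?_, ?_⟩
    · change ⁅x + r, (φ : Module.End K L)⁆ = 0
      rw [add_lie, ← hrx, hRM r hr _ hφR 1 (fun n hn ↦ by rw [hφ1 n hn, one_smul]), one_smul,
        ← map_add, add_neg_cancel, map_zero]
    · rw [sub_add_cancel_left]
      exact R.neg_mem hr

/-- Reduction to the abelian case in L/[R, R]: its radical R/[R, R] is abelian, and nonzero because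
R is solvable and nonzero. -/
theorem LieAlgebra.exists_subalgebra_of_radical_ne_bot (h0 : radical K L ≠ ⊥) :
    ∃ T : LieSubalgebra K L, T ≠ ⊤ ∧ ∀ x, ∃ t ∈ T, x - t ∈ radical K L := by
  set I : LieIdeal K L := ⁅radical K L, radical K L⁆ with hI
  have hIR : I ≤ radical K L := LieSubmodule.lie_le_right _ _
  have hne : ¬ radical K L ≤ I := by
    intro hle
    have heq : I = radical K L := le_antisymm hIR hle
    obtain ⟨k, hk⟩ := IsSolvable.solvable K (radical K L)
    rw [LieIdeal.derivedSeries_eq_bot_iff] at hk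
    have : ∀ j, derivedSeriesOfIdeal K L j (radical K L) = radical K L := by
      intro j
      induction j with
      | zero => simp
      | succ j ih => rw [derivedSeriesOfIdeal_succ, ih]; exact heq
    exact h0 (by rw [← this k, hk])
  set π := I.quotientHom with hπ
  have hπs : Function.Surjective π := I.quotientHom_surjective
  have : IsSolvable π.ker := by
    rw [LieIdeal.quotientHom_ker]
    exact le_solvable_ideal_solvable hIR inferInstance
  obtain ⟨T, hT, hTx⟩ := LieAlgebra.exists_subalgebra_of_abelian_radical (K := K) (L := L ⧸ I)
    (fun x hx y hy ↦ by
      obtain ⟨x, rfl⟩ := hπs x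
      obtain ⟨y, rfl⟩ := hπs y
      rw [← LieHom.map_lie, LieIdeal.quotientHom_eq_zero]
      exact LieSubmodule.lie_mem_lie ((mem_radical_of_surjective hπs).2 hx)
        ((mem_radical_of_surjective hπs).2 hy))
    (fun hbot ↦ hne fun x hx ↦ by
      have := map_mem_radical hπs hx
      rwa [hbot, LieSubmodule.mem_bot, LieIdeal.quotientHom_eq_zero] at this)
  refine ⟨T.comap π, fun htop ↦ hT ?_, fun x ↦ ?_⟩
  · rw [eq_top_iff]
    intro y _
    obtain ⟨x, rfl⟩ := hπs y
    have : x ∈ T.comap π := by rw [htop]; trivial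
    exact this
  · obtain ⟨t, ht, hxt⟩ := hTx (π x)
    obtain ⟨t, rfl⟩ := hπs t
    refine ⟨t, ht, ?_⟩
    rw [mem_radical_of_surjective hπs, map_sub]
    exact hxt

/-- T maps onto the semisimple quotient of L by its radical, and the radical of T goes to the zero
radical there. -/
theorem LieSubalgebra.mem_radical_of_surjective_mod {T : LieSubalgebra K L}
    (hT : ∀ x, ∃ t ∈ T, x - t ∈ radical K L) {r : T} (hr : r ∈ radical K T) :
    (r : L) ∈ radical K L := by
  set π := (radical K L).quotientHom
  have hs : Function.Surjective (π.comp T.incl) := by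
    intro y
    obtain ⟨x, rfl⟩ := (radical K L).quotientHom_surjective y
    obtain ⟨t, ht, hxt⟩ := hT x
    refine ⟨⟨t, ht⟩, ?_⟩
    rw [← LieIdeal.quotientHom_eq_zero, map_sub, sub_eq_zero] at hxt
    exact hxt.symm
  have := map_mem_radical hs hr
  exact (LieIdeal.quotientHom_eq_zero _).1
    ((LieSubmodule.eq_bot_iff _).1 HasTrivialRadical.radical_eq_bot _ this)

theorem LieAlgebra.exists_levi_aux (n : ℕ) :
    ∀ (L : Type _) [LieRing L] [LieAlgebra K L] [FiniteDimensional K L], finrank K L = n →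
      ∃ S : LieSubalgebra K L, HasTrivialRadical K S ∧ ∀ x, ∃ s ∈ S, x - s ∈ radical K L := by
  induction n using Nat.strong_induction_on with
  | _ n ih =>
    intro L _ _ _ hn
    by_cases h0 : radical K L = ⊥
    · refine ⟨⊤, ?_, fun x ↦ ⟨x, trivial, by simp⟩⟩
      exact hasTrivialRadical_of_surjective
        (f := (LieSubalgebra.topEquiv.symm : L ≃ₗ⁅K⁆ (⊤ : LieSubalgebra K L)).toLieHom)
        (LieSubalgebra.topEquiv.symm).surjective (by rw [h0]; exact bot_le)
    · obtain ⟨T, hT, hTx⟩ := LieAlgebra.exists_subalgebra_of_radical_ne_bot h0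
      obtain ⟨S, hS, hSx⟩ := ih (finrank K T) (by
        rw [← hn]
        refine Submodule.finrank_lt (s := T.toSubmodule) (fun h ↦ hT ?_)
        exact LieSubalgebra.toSubmodule_injective h) T rfl
      have hs : Function.Surjective (T.incl.comp S.incl).rangeRestrict :=
        LieHom.surjective_rangeRestrict _
      refine ⟨(T.incl.comp S.incl).range, hasTrivialRadical_of_surjective (K := K) hs
        (by rw [HasTrivialRadical.radical_eq_bot]; exact bot_le), fun x ↦ ?_⟩
      obtain ⟨t, ht, hxt⟩ := hTx x
      obtain ⟨s, hs, hts⟩ := hSx ⟨t, ht⟩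
      refine ⟨s, ⟨⟨s, hs⟩, rfl⟩, ?_⟩
      have h1 := LieSubalgebra.mem_radical_of_surjective_mod hTx hts
      have := add_mem hxt h1
      simpa using this

variable (K L) in
/-- **Levi's theorem**. -/
theorem LieAlgebra.exists_levi : ∃ S : LieSubalgebra K L, HasTrivialRadical K S ∧
    ∀ x, ∃ s ∈ S, x - s ∈ radical K L :=
  LieAlgebra.exists_levi_aux _ L rfl

variable (K L) in
-- By invariance the Killing complement of [L, L] is central, hence zero.
theorem LieAlgebra.lie_top_top_eq_top [HasTrivialRadical K L] :
    ⁅(⊤ : LieIdeal K L), (⊤ : LieIdeal K L)⁆ = ⊤ := by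
  have hc := LieIdeal.isCompl_killingCompl ⁅(⊤ : LieIdeal K L), (⊤ : LieIdeal K L)⁆
  have hbot : LieIdeal.killingCompl K L ⁅(⊤ : LieIdeal K L), (⊤ : LieIdeal K L)⁆ = ⊥ := by
    rw [LieSubmodule.eq_bot_iff]
    intro x hx
    have h1 : x ∈ center K L := fun y ↦ by
      refine (IsKilling.killingForm_nondegenerate K L).1 _ fun z ↦ ?_
      rw [← lie_skew, map_neg, LinearMap.neg_apply, traceForm_apply_lie_apply, neg_eq_zero,
        traceForm_comm]
      exact (LieIdeal.mem_killingCompl K L _).1 hx _ (LieSubmodule.lie_mem_lie trivial trivial)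
    rwa [center_eq_bot, LieSubmodule.mem_bot] at h1
  simpa [hbot] using hc.sup_eq_top

/-- The abstract Jordan decomposition in a semisimple Lie algebra. -/
theorem LieAlgebra.exists_isJordanChevalley_toEnd [HasTrivialRadical K L] (V : Type*)
    [AddCommGroup V] [Module K V] [LieRingModule L V] [LieModule K L V] [FiniteDimensional K V]
    (x : L) :
    ∃ a b : L, a + b = x ∧ IsJordanChevalley (toEnd K L V x) (toEnd K L V a) (toEnd K L V b) := by
  have had : ∀ y z : L, ad K L y = ad K L z → y = z := by
    intro y z h
    rw [← sub_eq_zero, ← map_sub] at h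
    have : y - z ∈ (ad K L).ker := LieHom.mem_ker.2 h
    rw [ad_ker_eq_bot_of_hasTrivialRadical, LieSubmodule.mem_bot] at this
    exact sub_eq_zero.1 this
  obtain ⟨S, -, N, -, hJ⟩ := IsJordanChevalley.exists_mem_adjoin (ad K L x)
  have hder : ∀ y z, N ⁅y, z⁆ = ⁅N y, z⁆ + ⁅y, N z⁆ :=
    hJ.nilpotent_leibniz fun y z ↦ by simp
  -- The nilpotent component of ad x is a derivation, and derivations of a semisimple Lie algebra
  -- are inner.
  obtain ⟨b, hb⟩ := LieDerivation.IsKilling.exists_eq_ad (R := K) (L := L)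
    { N with
      leibniz' := fun y z ↦ by
        change N ⁅y, z⁆ = ⁅y, N z⁆ - ⁅z, N y⁆
        rw [hder, ← lie_skew z, sub_neg_eq_add, add_comm] }
  have hbN : ad K L b = N := by
    ext y
    have := LieDerivation.congr_fun hb y
    rw [LieDerivation.ad_apply_apply] at this
    exact this
  have haS : ad K L (x - b) = S := by rw [map_sub, hbN, ← hJ.add_eq, add_sub_cancel_right]
  rw [← hbN, ← haS] at hJ
  set a := x - b with ha
  have hab : ⁅a, b⁆ = 0 := by
    refine had _ _ ?_
    rw [LieHom.map_lie, map_zero]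
    exact hJ.commute.lie_eq
  have hcomm : Commute (toEnd K L V a) (toEnd K L V b) := by
    rw [commute_iff_lie_eq, ← LieHom.map_lie, hab, map_zero]
  have hf : ∀ y v, (toEnd K L V : L →ₗ[K] Module.End K V) (ad K L y v) =
      ad K (Module.End K V) (toEnd K L V y) ((toEnd K L V : L →ₗ[K] Module.End K V) v) := by
    intro y v
    exact LieHom.map_lie _ _ _
  have hJb : IsJordanChevalley (ad K L b) 0 (ad K L b) :=
    ⟨zero_add _, Commute.zero_left _, Module.End.isSemisimple_zero, hJ.nilpotent⟩
  have hJa : IsJordanChevalley (ad K L a) (ad K L a) 0 :=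
    ⟨add_zero _, Commute.zero_right _, hJ.semisimple, _root_.IsNilpotent.zero⟩
  refine ⟨a, b, sub_add_cancel x b, ?_, hcomm, ?_, ?_⟩
  · rw [← map_add, sub_add_cancel]
  -- Since ad a has no nilpotent component, N' commutes with L; complete reducibility then forces N'
  -- = 0.
  · obtain ⟨C, -, N', hN', hC⟩ := IsJordanChevalley.exists_mem_adjoin (toEnd K L V a)
    have hcN : ∀ (y : L) (v : V), N' ⁅y, v⁆ = ⁅y, N' v⁆ := by
      intro y v
      have h1 := hJa.nilpotent_comp hC.ad (hf a) y
      rw [LinearMap.zero_apply, map_zero] at h1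
      have h2 := LinearMap.congr_fun h1 v
      change 0 = N' (toEnd K L V y v) - toEnd K L V y (N' v) at h2
      exact sub_eq_zero.1 h2.symm
    have hrad : radical K L = ⊥ := HasTrivialRadical.radical_eq_bot
    have hss : IsSemisimpleLieModule K L V := by
      refine LieModule.isSemisimple_of_radical (fun x hx ↦ ?_) fun x hx y v ↦ ?_
      · rw [hrad, LieSubmodule.mem_bot] at hx
        rw [hx, map_zero]; exact Module.End.isSemisimple_zero
      · rw [hrad, LieSubmodule.mem_bot] at hx
        rw [hx, lie_zero, zero_lie]
    have h0 := hss.eq_zero_of_isNilpotent hC.nilpotent hcN fun W v hv ↦ W.mem_of_mem_adjoin hN' hv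
    rw [← hC.add_eq, h0, add_zero]
    exact hC.semisimple
  -- Since ad b has no semisimple component, C commutes with L. As b is a sum of brackets, the trace
  -- criterion makes C nilpotent, hence zero.
  · obtain ⟨C, hC', N', -, hC⟩ := IsJordanChevalley.exists_mem_adjoin (toEnd K L V b)
    have h0 : C = 0 := by
      refine Module.End.eq_zero_of_isNilpotent_isSemisimple ?_ hC.semisimple
      refine Module.End.isNilpotent_of_commute_of_mem_span (B := toEnd K L V b)
        (s := toEnd K L V '' (⊤ : LieIdeal K L)) ?_ (LieModule.toEnd_mem_span ⊤ ⊤ ?_) ?_ ?_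
      · rintro _ ⟨y, -, rfl⟩
        have h1 := hJb.semisimple_comp hC.ad (hf b) y
        rw [LinearMap.zero_apply, map_zero] at h1
        exact commute_iff_lie_eq.2 h1.symm
      · rw [LieAlgebra.lie_top_top_eq_top]; trivial
      · rw [← hC.add_eq, add_sub_cancel_left]; exact hC.nilpotent
      · exact Algebra.commute_of_mem_adjoin_self hC'
    rw [← hC.add_eq, h0, zero_add]
    exact hC.nilpotent

end Levi

/-! ### The nilradical, the radical and the Killing form. -/

section Nilradical

attribute [local instance 100] LieRing.ofAssociativeRing

open LieModule LieAlgebra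

variable {K L : Type*} [Field K] [LieRing L] [LieAlgebra K L]

theorem LieIdeal.coe_ad_pow (I : LieIdeal K L) (x y : I) (k : ℕ) :
    ((((ad K I x) ^ k) y : I) : L) = ((ad K L (x : L)) ^ k) (y : L) := by
  induction k with
  | zero => simp
  | succ k ih =>
    rw [pow_succ', Module.End.mul_apply, pow_succ', Module.End.mul_apply, ← ih]
    rfl

/-- An ideal is nilpotent if and only if it consists of ad-nilpotent elements. -/
theorem LieIdeal.isNilpotent_iff_forall_ad [FiniteDimensional K L] (I : LieIdeal K L) :
    LieRing.IsNilpotent I ↔ ∀ x ∈ I, _root_.IsNilpotent (ad K L x) := by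
  rw [LieAlgebra.isNilpotent_iff_forall (R := K)]
  constructor
  · intro h x hx
    obtain ⟨k, hk⟩ := h ⟨x, hx⟩
    refine ⟨k + 1, ?_⟩
    ext y
    have := I.coe_ad_pow ⟨x, hx⟩ ⟨⁅x, y⁆, lie_mem_left K L I x y hx⟩ k
    rw [hk] at this
    rw [pow_succ, Module.End.mul_apply]
    exact this.symm
  · intro h x
    obtain ⟨k, hk⟩ := h x x.2
    refine ⟨k, ?_⟩
    ext y
    rw [I.coe_ad_pow, hk]
    rfl

variable [FiniteDimensional K L]

variable (K L) in
-- Sums of two nilpotent ideals consist of ad-nilpotent elements, and by the ascending chain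
-- condition the supremum is attained within such a family.
theorem nilradicalIdeal_isNilpotent : LieRing.IsNilpotent (nilradicalIdeal K L) := by
  have hwf := LieSubmodule.wellFoundedGT_of_noetherian K L L
  rw [← CompleteLattice.isSupClosedCompact_iff_wellFoundedGT] at hwf
  refine hwf {I : LieIdeal K L | LieRing.IsNilpotent I} ⟨⊥, ?_⟩ fun I hI J hJ ↦ ?_
  · change LieRing.IsNilpotent (⊥ : LieIdeal K L)
    infer_instance
  · change LieRing.IsNilpotent I at hI
    change LieRing.IsNilpotent J at hJ
    change LieRing.IsNilpotent (I ⊔ J : LieIdeal K L)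
    rw [LieIdeal.isNilpotent_iff_forall_ad] at hI hJ ⊢
    intro x hx
    obtain ⟨a, ha, b, hb, rfl⟩ := (LieSubmodule.mem_sup _ _ _).1 hx
    have := LieIdeal.isNilpotent_of_forall_toEnd (V := L) I hI
    exact LieIdeal.isNilpotent_toEnd_add (V := L) I ha (hJ b hb)

theorem isNilpotent_ad_of_mem_nilradicalIdeal {x : L} (hx : x ∈ nilradicalIdeal K L) :
    _root_.IsNilpotent (ad K L x) :=
  (LieIdeal.isNilpotent_iff_forall_ad _).1 (nilradicalIdeal_isNilpotent K L) x hx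

instance nilradicalIdeal_isNilpotent_module : LieModule.IsNilpotent (nilradicalIdeal K L) L :=
  LieIdeal.isNilpotent_of_forall_toEnd _ fun _ ↦ isNilpotent_ad_of_mem_nilradicalIdeal

theorem LieIdeal.le_nilradicalIdeal {I : LieIdeal K L}
    (h : ∀ x ∈ I, _root_.IsNilpotent (ad K L x)) : I ≤ nilradicalIdeal K L :=
  le_sSup (a := I) ((LieIdeal.isNilpotent_iff_forall_ad I).2 h)

theorem killingForm_eq_zero_of_mem_nilradicalIdeal {x y : L} (hy : y ∈ nilradicalIdeal K L) :
    killingForm K L x y = 0 := by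
  rw [traceForm_comm]
  exact (LinearMap.isNilpotent_trace_of_isNilpotent
    ((nilradicalIdeal K L).isNilpotent_toEnd_mul (V := L) hy x)).eq_zero

variable [CharZero K]

/-- Elements of the radical that are ad-nilpotent belong to the nilradical. -/
theorem mem_nilradicalIdeal_of_mem_radical {x : L} (hx : x ∈ radical K L)
    (hn : _root_.IsNilpotent (ad K L x)) : x ∈ nilradicalIdeal K L := by
  set I : LieIdeal K L := ⁅(⊤ : LieIdeal K L), radical K L⁆ with hI
  have hIn : LieModule.IsNilpotent I L := LieModule.isNilpotent_lie_solvable (radical K L)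
  -- Kx + [L, rad L] is an ideal because [L, x] already lies in the second summand.
  let J : LieIdeal K L :=
    { (Submodule.span K {x} ⊔ I.toSubmodule) with
      lie_mem := by
        intro y z hz
        change z ∈ Submodule.span K {x} ⊔ I.toSubmodule at hz
        change ⁅y, z⁆ ∈ Submodule.span K {x} ⊔ I.toSubmodule
        obtain ⟨a, ha, b, hb, rfl⟩ := Submodule.mem_sup.1 hz
        obtain ⟨c, rfl⟩ := Submodule.mem_span_singleton.1 ha
        refine Submodule.mem_sup_right ?_
        rw [lie_add, lie_smul]
        exact add_mem (I.smul_mem c (LieSubmodule.lie_mem_lie trivial hx)) (I.lie_mem hb) }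
  have hJ : J ≤ nilradicalIdeal K L := by
    refine LieIdeal.le_nilradicalIdeal fun z hz ↦ ?_
    change z ∈ Submodule.span K {x} ⊔ I.toSubmodule at hz
    obtain ⟨a, ha, b, hb, rfl⟩ := Submodule.mem_sup.1 hz
    obtain ⟨c, rfl⟩ := Submodule.mem_span_singleton.1 ha
    rw [add_comm]
    refine I.isNilpotent_toEnd_add (V := L) hb ?_
    rw [map_smul]
    exact hn.smul c
  exact hJ (Submodule.mem_sup_left (Submodule.mem_span_singleton_self x) :
    x ∈ Submodule.span K {x} ⊔ I.toSubmodule)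

theorem lie_radical_le_nilradicalIdeal :
    ⁅(⊤ : LieIdeal K L), radical K L⁆ ≤ nilradicalIdeal K L := by
  have := LieModule.isNilpotent_lie_solvable (V := L) (radical K L)
  exact LieIdeal.le_nilradicalIdeal fun x hx ↦ LieModule.isNilpotent_toEnd_of_isNilpotent K
    (⁅(⊤ : LieIdeal K L), radical K L⁆ : LieIdeal K L) L ⟨x, hx⟩

/-- By invariance the value is the trace form at ([x, y], z), and [x, y] lies in an ideal acting
nilpotently. -/
theorem LieModule.traceForm_lie_eq_zero_of_mem_radical (V : Type*) [AddCommGroup V] [Module K V]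
    [LieRingModule L V] [LieModule K L V] [FiniteDimensional K V] {x : L}
    (hx : x ∈ radical K L) (y z : L) : traceForm K L V x ⁅y, z⁆ = 0 := by
  have := LieModule.isNilpotent_lie_solvable (V := V) (radical K L)
  rw [← traceForm_apply_lie_apply, ← lie_skew, map_neg, LinearMap.neg_apply, neg_eq_zero]
  exact (LinearMap.isNilpotent_trace_of_isNilpotent
    (LieIdeal.isNilpotent_toEnd_mul (V := V) ⁅(⊤ : LieIdeal K L), radical K L⁆
      (LieSubmodule.lie_mem_lie trivial hx) z)).eq_zero

/-- The radical is the orthogonal of the derived algebra for the Killing form. -/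
theorem LieAlgebra.mem_radical_iff {x : L} :
    x ∈ radical K L ↔ ∀ y z : L, killingForm K L x ⁅y, z⁆ = 0 := by
  refine ⟨fun hx y z ↦ LieModule.traceForm_lie_eq_zero_of_mem_radical L hx y z, fun h ↦ ?_⟩
  set D : LieIdeal K L := ⁅(⊤ : LieIdeal K L), (⊤ : LieIdeal K L)⁆ with hD
  have hmem : x ∈ LieIdeal.killingCompl K L D := by
    rw [LieIdeal.mem_killingCompl]
    intro y hy
    rw [hD, ← LieSubmodule.mem_toSubmodule, LieSubmodule.lieIdeal_oper_eq_linear_span'] at hy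
    rw [traceForm_comm]
    induction hy using Submodule.span_induction with
    | mem y hy => obtain ⟨a, -, b, -, rfl⟩ := hy; exact h a b
    | zero => simp
    | add a b _ _ ha hb => rw [map_add, ha, hb, add_zero]
    | smul c a _ ha => rw [map_smul, ha, smul_zero]
  refine mem_radical_of_mem (LieIdeal.isSolvable_of_killingForm_apply_lie_eq_zero _ ?_) hmem
  intro a ha b hb
  rw [traceForm_comm]
  exact (LieIdeal.mem_killingCompl K L D).1 ha b (LieSubmodule.mono_lie le_top le_top hb)

end Nilradical

/-! ### Conjugation by exponentials of nilpotent derivations. -/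

section Conjugation

attribute [local instance 100] LieRing.ofAssociativeRing

open LieModule LieAlgebra

variable {K L : Type*} [Field K] [LieRing L] [LieAlgebra K L]

theorem IsJordanChevalley.of_conj {V W : Type*} [AddCommGroup V] [Module K V]
    [AddCommGroup W] [Module K W] (e : V ≃ₗ[K] W) {A S N : Module.End K V}
    (h : IsJordanChevalley (e.conj A) (e.conj S) (e.conj N)) : IsJordanChevalley A S N where
  add_eq := e.conj.injective (by rw [map_add, h.add_eq])
  commute := by
    have := h.commute.eq
    rw [Module.End.mul_eq_comp, Module.End.mul_eq_comp, ← LinearEquiv.conj_comp,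
      ← LinearEquiv.conj_comp] at this
    exact e.conj.injective this
  semisimple := by
    refine (LinearEquiv.isSemisimple_iff S (e.conj S) e ?_).2 h.semisimple
    ext v
    simp [LinearEquiv.conj_apply_apply]
  nilpotent := by
    obtain ⟨k, hk⟩ := h.nilpotent
    refine ⟨k, e.conj.injective ?_⟩
    rw [map_zero, ← hk]
    clear hk h
    induction k with
    | zero => ext v; simp [LinearEquiv.conj_apply_apply]
    | succ k ih =>
      rw [pow_succ, pow_succ, ← ih, Module.End.mul_eq_comp, Module.End.mul_eq_comp,
        LinearEquiv.conj_comp]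

/-- On its Fitting kernel f is both nilpotent and semisimple, hence zero. -/
theorem Module.End.IsSemisimple.exists_add_apply {V : Type*} [AddCommGroup V] [Module K V]
    [FiniteDimensional K V] {f : Module.End K V} (hf : f.IsSemisimple) (w : V) :
    ∃ w₀ u, f w₀ = 0 ∧ w = w₀ + f u := by
  obtain ⟨k, hk⟩ := Filter.eventually_atTop.1 f.eventually_isCompl_ker_pow_range_pow
  replace hk := hk (k + 1) (by omega)
  have hw : w ∈ LinearMap.ker (f ^ (k + 1)) ⊔ LinearMap.range (f ^ (k + 1)) := by
    rw [hk.sup_eq_top]; trivial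
  obtain ⟨w₀, hw₀, _, ⟨u, rfl⟩, rfl⟩ := Submodule.mem_sup.1 hw
  refine ⟨w₀, (f ^ k) u, ?_, by rw [pow_succ', Module.End.mul_apply]⟩
  have hinv : ∀ v ∈ LinearMap.ker (f ^ (k + 1)), f v ∈ LinearMap.ker (f ^ (k + 1)) := by
    intro v hv
    rw [LinearMap.mem_ker, ← Module.End.mul_apply, ← pow_succ, pow_succ',
      Module.End.mul_apply, LinearMap.mem_ker.1 hv, map_zero]
  have h0 := Module.End.eq_zero_of_isNilpotent_isSemisimple (f := f.restrict hinv) ⟨k + 1, by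
    ext v
    rw [Module.End.pow_restrict]
    exact v.2⟩ (hf.restrict hinv)
  exact congrArg Subtype.val (LinearMap.congr_fun h0 ⟨w₀, hw₀⟩)

variable [CharZero K]

/-- The exponential of a nilpotent inner derivation, up to terms of order at least two. -/
theorem LieAlgebra.exists_exp_ad {u : L} (hu : _root_.IsNilpotent (ad K L u)) :
    ∃ θ : L ≃ₗ⁅K⁆ L, ∀ (G : Submodule K L) (z : L),
      (∀ i, 2 ≤ i → ((ad K L u) ^ i) z ∈ G) → θ z - z - ⁅u, z⁆ ∈ G := by
  -- The exponential is formed over ℚ, so the rational structure is induced from K.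
  let _ : Algebra ℚ K := DivisionRing.toRatAlgebra
  let _ : Module ℚ L := Module.compHom L (algebraMap ℚ K)
  let _ : IsScalarTower ℚ K L := ⟨fun a b c ↦ by
    rw [Algebra.smul_def, mul_smul]; rfl⟩
  let _ : LieAlgebra ℚ L :=
    { lie_smul := fun t x y ↦ LieModule.lie_smul (R := K) (algebraMap ℚ K t) x y }
  set D := LieDerivation.ad K L u
  have hD : D.toLinearMap = ad K L u := by ext y; simp [D]
  have hn : _root_.IsNilpotent D.toLinearMap := by rwa [hD]
  refine ⟨LieDerivation.exp D hn, fun G z hz ↦ ?_⟩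
  obtain ⟨k, hk⟩ := id hn
  -- The bound k + 2 lets the terms of order 0 and 1 be split off whatever k is.
  have hk2 : D.toLinearMap ^ (k + 2) = 0 := by rw [pow_add, hk, zero_mul]
  rw [LieDerivation.exp_map_apply, IsNilpotent.exp_eq_sum hk2, Finset.sum_range_succ',
    Finset.sum_range_succ']
  simp only [LinearMap.add_apply, LinearMap.sum_apply]
  have h2 : ∑ i ∈ Finset.range k,
      (((i + 1 + 1).factorial : ℚ)⁻¹ • D.toLinearMap ^ (i + 1 + 1)) z ∈ G := by
    refine Submodule.sum_mem _ fun i _ ↦ ?_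
    rw [hD]
    exact G.smul_mem (algebraMap ℚ K _) (hz (i + 1 + 1) (by omega))
  convert h2 using 1
  simp [hD]

variable [FiniteDimensional K L]

/-- Successive approximation along the lower central series of L under J; j counts the remaining
steps. Semisimplicity of ad t splits the error as w = w₀ + [t, u] with [t, w₀] = 0. The automorphism
exp(ad u) removes [t, u] up to the next term, while w₀ is absorbed into v. Once the error is zero,
ad t and ad v are the components. -/
theorem LieAlgebra.exists_isJordanChevalley_ad_aux {J : LieSubalgebra K L}
    (hJ : ∀ x ∈ J, _root_.IsNilpotent (ad K L x)) {p : ℕ} (hp : lowerCentralSeries K J L p = ⊥)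
    {t : L} (ht : (ad K L t).IsSemisimple) (htJ : ∀ x ∈ J, ⁅t, x⁆ ∈ J) (j : ℕ) :
    ∀ k, k + j = p → ∀ v ∈ J, ⁅t, v⁆ = 0 → ∀ w ∈ J, w ∈ lowerCentralSeries K J L k →
      ∃ a b : L, IsJordanChevalley (ad K L (t + v + w)) (ad K L a) (ad K L b) := by
  have htF : ∀ k, ∀ w ∈ lowerCentralSeries K J L k, ⁅t, w⁆ ∈ lowerCentralSeries K J L k := by
    intro k
    induction k with
    | zero => intro w _; trivial
    | succ k ih =>
      intro w hw
      rw [lowerCentralSeries_succ] at hw ⊢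
      rw [← LieSubmodule.mem_toSubmodule, LieSubmodule.lieIdeal_oper_eq_linear_span'] at hw
      induction hw using Submodule.span_induction with
      | mem w hw =>
        obtain ⟨x, -, m, hm, rfl⟩ := hw
        have h1 : ⁅(⟨⁅t, (x : L)⁆, htJ _ x.2⟩ : J), m⁆ + ⁅x, ⁅t, m⁆⁆ ∈
            ⁅(⊤ : LieIdeal K J), lowerCentralSeries K J L k⁆ :=
          add_mem (LieSubmodule.lie_mem_lie trivial hm) (LieSubmodule.lie_mem_lie trivial (ih m hm))
        rw [LieSubalgebra.coe_bracket_of_module, LieSubalgebra.coe_bracket_of_module] at h1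
        rw [LieSubalgebra.coe_bracket_of_module, leibniz_lie]
        exact h1
      | zero => rw [lie_zero]; exact zero_mem _
      | add a b _ _ ha hb => rw [lie_add]; exact add_mem ha hb
      | smul c a _ ha => rw [lie_smul]; exact Submodule.smul_mem _ c ha
  have hJF : ∀ k, ∀ x ∈ J, ∀ w ∈ lowerCentralSeries K J L k,
      ⁅x, w⁆ ∈ lowerCentralSeries K J L (k + 1) := by
    intro k x hx w hw
    rw [lowerCentralSeries_succ]
    exact LieSubmodule.lie_mem_lie (x := (⟨x, hx⟩ : J)) trivial hw
  induction j with
  | zero =>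
    intro k hk v hv htv w _ hw
    obtain rfl : k = p := by omega
    rw [hp, LieSubmodule.mem_bot] at hw
    refine ⟨t, v, by rw [hw, add_zero, map_add], ?_, ht, hJ v hv⟩
    rw [commute_iff_lie_eq, ← LieHom.map_lie, htv, map_zero]
  | succ j ih =>
    intro k hk v hv htv w hwJ hwF
    set G : Submodule K L := J.toSubmodule ⊓ (lowerCentralSeries K J L k).toSubmodule with hG
    have hGt : G ∈ (ad K L t).invtSubmodule := fun x hx ↦ ⟨htJ x hx.1, htF k x hx.2⟩
    obtain ⟨w₀, u, hw₀, hwu⟩ := (ht.restrict hGt).exists_add_apply ⟨w, hwJ, hwF⟩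
    replace hw₀ : ⁅t, (w₀ : L)⁆ = 0 := congrArg Subtype.val hw₀
    replace hwu : w = w₀ + ⁅t, (u : L)⁆ := congrArg Subtype.val hwu
    set G' : Submodule K L :=
      J.toSubmodule ⊓ (lowerCentralSeries K J L (k + 1)).toSubmodule with hG'
    have huJ : (u : L) ∈ J := u.2.1
    have huF : (u : L) ∈ lowerCentralSeries K J L k := u.2.2
    have h1 : ⁅(u : L), v + w⁆ ∈ G' := by
      refine ⟨J.lie_mem huJ (add_mem hv hwJ), ?_⟩
      rw [← lie_skew]
      exact neg_mem (hJF k _ (add_mem hv hwJ) _ huF)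
    have h2 : ∀ x ∈ G, ⁅(u : L), x⁆ ∈ G' := fun x hx ↦ ⟨J.lie_mem huJ hx.1, hJF k _ huJ _ hx.2⟩
    have hle : G' ≤ G := fun x hx ↦ ⟨hx.1, antitone_lowerCentralSeries K J L (Nat.le_succ k) hx.2⟩
    have h3 : ⁅(u : L), t + v + w⁆ ∈ G := by
      rw [add_assoc, lie_add]
      refine add_mem ?_ (hle h1)
      rw [← lie_skew]
      exact neg_mem (hGt u.2)
    have h4 : ∀ i, ((ad K L (u : L)) ^ (i + 2)) (t + v + w) ∈ G' := by
      intro i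
      induction i with
      | zero =>
        rw [zero_add, pow_two, Module.End.mul_apply]
        exact h2 _ h3
      | succ i ih => rw [add_right_comm, pow_succ', Module.End.mul_apply]; exact h2 _ (hle ih)
    obtain ⟨θ, hθ⟩ := LieAlgebra.exists_exp_ad (hJ u huJ)
    have h5 := hθ G' (t + v + w) fun i hi ↦ by
      obtain ⟨i, rfl⟩ := Nat.exists_eq_add_of_le' hi
      exact h4 i
    have h6 : θ (t + v + w) - (t + (v + w₀)) ∈ G' := by
      convert add_mem h5 h1 using 1
      have h7 : ⁅(u : L), t + v + w⁆ = -⁅t, (u : L)⁆ + ⁅(u : L), v + w⁆ := by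
        rw [add_assoc, lie_add, lie_skew]
      have h8 : ⁅t, (u : L)⁆ = w - w₀ := by rw [hwu, add_sub_cancel_left]
      rw [h7, h8]
      abel
    obtain ⟨a, b, hab⟩ := ih (k + 1) (by omega) (v + w₀) (add_mem hv w₀.2.1)
      (by rw [lie_add, htv, hw₀, add_zero]) _ h6.1 h6.2
    rw [add_sub_cancel] at hab
    refine ⟨θ.symm a, θ.symm b, IsJordanChevalley.of_conj θ.toLinearEquiv ?_⟩
    rw [LieAlgebra.conj_ad_apply, LieAlgebra.conj_ad_apply, LieAlgebra.conj_ad_apply,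
      LieEquiv.apply_symm_apply, LieEquiv.apply_symm_apply]
    exact hab

/-- The Jordan–Chevalley components of `t + v` are inner, when `t` is ad-semisimple and normalizes
an ad-nilpotent subalgebra containing `v`. -/
theorem LieAlgebra.exists_isJordanChevalley_ad {J : LieSubalgebra K L}
    (hJ : ∀ x ∈ J, _root_.IsNilpotent (ad K L x)) {t : L} (ht : (ad K L t).IsSemisimple)
    (htJ : ∀ x ∈ J, ⁅t, x⁆ ∈ J) {v : L} (hv : v ∈ J) :
    ∃ a b : L, IsJordanChevalley (ad K L (t + v)) (ad K L a) (ad K L b) := by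
  have : LieModule.IsNilpotent J L :=
    (LieModule.isNilpotent_iff_forall' (R := K)).2 fun x ↦ hJ x x.2
  obtain ⟨p, hp⟩ := LieModule.IsNilpotent.nilpotent K J L
  have := LieAlgebra.exists_isJordanChevalley_ad_aux hJ hp ht htJ p 0 (by omega) 0 J.zero_mem
    (lie_zero t) v hv (by rw [lowerCentralSeries_zero]; trivial)
  rwa [add_zero] at this

end Conjugation

/-! ### Gradings, the Killing form and the radical. -/

section Graded

attribute [local instance 100] LieRing.ofAssociativeRing

open LieModule LieAlgebra DirectSum

variable {K 𝔤 : Type*} [Field K] [LieRing 𝔤] [LieAlgebra K 𝔤] (𝒜 : ℤ → Submodule K 𝔤)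

theorem Module.End.isNilpotent_of_forall_mem_add {V : Type*} [AddCommGroup V] [Module K V]
    [FiniteDimensional K V] (ℬ : ℤ → Submodule K V) [Decomposition ℬ] {d : ℤ} (hd : d ≠ 0)
    {T : Module.End K V} (hT : ∀ p, ∀ x ∈ ℬ p, T x ∈ ℬ (p + d)) : IsNilpotent T := by
  have hfin := WellFoundedGT.finite_ne_bot_of_iSupIndep
    (Decomposition.isInternal ℬ).submodule_iSupIndep
  obtain ⟨B, hB⟩ : ∃ B : ℕ, ∀ p, ℬ p ≠ ⊥ → p.natAbs < B := by
    obtain ⟨B, hB⟩ := (hfin.image Int.natAbs).bddAbove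
    exact ⟨B + 1, fun p hp ↦ Nat.lt_succ_of_le (hB ⟨p, hp, rfl⟩)⟩
  have hpow : ∀ k : ℕ, ∀ p, ∀ x ∈ ℬ p, (T ^ k) x ∈ ℬ (p + k * d) := by
    intro k
    induction k with
    | zero => intro p x hx; simpa using hx
    | succ k ih =>
      intro p x hx
      rw [pow_succ', Module.End.mul_apply]
      convert hT _ _ (ih p x hx) using 2
      push_cast
      ring
  -- Nonzero degrees have absolute value below B, so two of them cannot differ by 2B|d| or more.
  refine ⟨2 * B, ?_⟩
  ext x
  induction x using Decomposition.inductionOn ℬ with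
  | zero => simp
  | add x y hx hy => rw [map_add, hx, hy, map_add]
  | @homogeneous p x =>
    by_contra hne
    have h1 : ℬ p ≠ ⊥ := fun h0 ↦ hne <| by
      have : (x : V) = 0 := (Submodule.mem_bot K).1 (h0 ▸ x.2)
      rw [this, map_zero, map_zero]
    have h2 : ℬ (p + (2 * B : ℕ) * d) ≠ ⊥ := fun h0 ↦ hne <|
      (Submodule.mem_bot K).1 (h0 ▸ hpow (2 * B) p x x.2)
    have h3 := hB _ h1
    have h4 := hB _ h2
    have h5 : (2 * B : ℤ) ≤ |((2 * B : ℕ) : ℤ) * d| := by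
      rw [abs_mul]
      push_cast
      have : (1 : ℤ) ≤ |d| := Int.one_le_abs hd
      rw [abs_of_nonneg (by positivity)]
      nlinarith
    have h6 := abs_sub (p + (2 * B : ℕ) * d) p
    rw [add_sub_cancel_left] at h6
    rw [← Int.natCast_natAbs p, ← Int.natCast_natAbs (p + (2 * B : ℕ) * d)] at h6
    omega

theorem LinearMap.mem_of_mem_adjoin {V : Type*} [AddCommGroup V] [Module K V] {A T : Module.End K V}
    (hT : T ∈ Algebra.adjoin K {A}) {P : Submodule K V} (hP : ∀ v ∈ P, A v ∈ P) {v : V}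
    (hv : v ∈ P) : T v ∈ P := by
  induction hT using Algebra.adjoin_induction generalizing v with
  | mem y hy => rw [Set.mem_singleton_iff.1 hy]; exact hP v hv
  | algebraMap r => exact P.smul_mem r hv
  | add y z _ _ h1 h2 => exact add_mem (h1 hv) (h2 hv)
  | mul y z _ _ h1 h2 => exact h1 (h2 hv)

variable [GradedLieAlgebra 𝒜]

variable {𝒜} in
theorem GradedLieAlgebra.lie_mem {p q : ℤ} {x y : 𝔤} (hx : x ∈ 𝒜 p) (hy : y ∈ 𝒜 q) :
    ⁅x, y⁆ ∈ 𝒜 (p + q) :=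
  SetLike.GradedBracket.bracket_mem (ℒ := 𝒜) hx hy

variable {𝒜} in
theorem GradedLieAlgebra.lie_mem_zero {q : ℤ} {x y : 𝔤} (hx : x ∈ 𝒜 0) (hy : y ∈ 𝒜 q) :
    ⁅x, y⁆ ∈ 𝒜 q := by
  simpa using GradedLieAlgebra.lie_mem hx hy

theorem GradedLieAlgebra.decompose_lie {p : ℤ} {x : 𝔤} (hx : x ∈ 𝒜 p) (y : 𝔤) (q : ℤ) :
    (decompose 𝒜 ⁅y, x⁆ (q + p) : 𝔤) = ⁅(decompose 𝒜 y q : 𝔤), x⁆ := by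
  induction y using Decomposition.inductionOn 𝒜 with
  | zero => simp
  | add y z hy hz => simp [hy, hz, add_lie, -decompose_bracket]
  | @homogeneous r y =>
    by_cases hr : r = q
    · subst hr
      rw [decompose_of_mem_same _ y.2, decompose_of_mem_same _ (GradedLieAlgebra.lie_mem y.2 hx)]
    · rw [decompose_of_mem_ne _ y.2 hr, zero_lie,
        decompose_of_mem_ne _ (GradedLieAlgebra.lie_mem y.2 hx) (by omega)]

section

variable {𝒜}

theorem IsAlmostEffective.eq_zero_of_mem (h : IsAlmostEffective 𝒜) {p : ℤ} (hp : 0 ≤ p) {x : 𝔤}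
    (hx : x ∈ 𝒜 p) (h0 : ∀ q < 0, ∀ y ∈ 𝒜 q, ⁅x, y⁆ = 0) : x = 0 := by
  refine h x (Submodule.mem_iSup_of_mem (⟨p, hp⟩ : {p : ℤ // 0 ≤ p}) hx) fun y hy ↦ ?_
  change y ∈ ⨆ p : {p : ℤ // p < 0}, 𝒜 p at hy
  induction hy using Submodule.iSup_induction' with
  | mem q z hz => exact h0 q q.2 z hz
  | zero => simp
  | add a b _ _ ha hb => rw [lie_add, ha, hb, add_zero]

theorem mem_negativePart {p : ℤ} (hp : p < 0) {x : 𝔤} (hx : x ∈ 𝒜 p) : x ∈ negativePart 𝒜 :=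
  Submodule.mem_iSup_of_mem (p := fun p : {p : ℤ // p < 0} ↦ 𝒜 p) ⟨p, hp⟩ hx

theorem IsAlmostEffective.eq_zero (h : IsAlmostEffective 𝒜) (x : structureSubalgebra 𝒜)
    (h0 : ∀ v : negativePart 𝒜, ⁅x, v⁆ = 0) : x = 0 := by
  refine Subtype.ext (h.eq_zero_of_mem le_rfl x.2 fun q hq y hy ↦ ?_)
  exact congrArg Subtype.val (h0 ⟨y, mem_negativePart hq hy⟩)

theorem IsSemisimpleLieModule.lieSubmodule {L V : Type*} [LieRing L] [LieAlgebra K L]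
    [AddCommGroup V] [Module K V] [LieRingModule L V] [LieModule K L V]
    (h : IsSemisimpleLieModule K L V) (N : LieSubmodule K L V) : IsSemisimpleLieModule K L N := by
  refine ⟨fun W ↦ ?_⟩
  obtain ⟨U, hU⟩ := h.exists_isCompl (W.map N.incl)
  refine ⟨U.comap N.incl, ?_, ?_⟩
  · rw [disjoint_iff, eq_bot_iff]
    intro v hv
    have h1 : (v : V) ∈ W.map N.incl ⊓ U :=
      ⟨⟨v, hv.1, rfl⟩, hv.2⟩
    rw [hU.inf_eq_bot, LieSubmodule.mem_bot] at h1
    exact Subtype.ext h1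
  · rw [codisjoint_iff, eq_top_iff]
    intro v _
    have h1 : (v : V) ∈ W.map N.incl ⊔ U := by rw [hU.sup_eq_top]; trivial
    obtain ⟨_, ⟨w, hw, rfl⟩, u, hu, hwu⟩ := (LieSubmodule.mem_sup _ _ _).1 h1
    refine (LieSubmodule.mem_sup _ _ _).2 ⟨w, hw, v - w, ?_, add_sub_cancel _ _⟩
    change ((v : V) - w) ∈ U
    rw [← hwu]
    exact (add_sub_cancel_left (w : V) u).symm ▸ hu

end

variable [FiniteDimensional K 𝔤]

theorem GradedLieAlgebra.isNilpotent_ad {p : ℤ} (hp : p ≠ 0) {x : 𝔤} (hx : x ∈ 𝒜 p) :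
    _root_.IsNilpotent (ad K 𝔤 x) :=
  Module.End.isNilpotent_of_forall_mem_add 𝒜 hp fun q y hy ↦ by
    rw [add_comm]; exact GradedLieAlgebra.lie_mem hx hy

theorem GradedLieAlgebra.killingForm_eq_zero {p q : ℤ} (hpq : p + q ≠ 0) {x y : 𝔤}
    (hx : x ∈ 𝒜 p) (hy : y ∈ 𝒜 q) : killingForm K 𝔤 x y = 0 := by
  rw [killingForm_apply_apply]
  refine (LinearMap.isNilpotent_trace_of_isNilpotent
    (Module.End.isNilpotent_of_forall_mem_add 𝒜 hpq fun r z hz ↦ ?_)).eq_zero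
  rw [show r + (p + q) = p + (q + r) by ring]
  exact GradedLieAlgebra.lie_mem hx (GradedLieAlgebra.lie_mem hy hz)

theorem GradedLieAlgebra.killingForm_decompose {p : ℤ} {y : 𝔤} (hy : y ∈ 𝒜 (-p)) (x : 𝔤) :
    killingForm K 𝔤 (decompose 𝒜 x p : 𝔤) y = killingForm K 𝔤 x y := by
  induction x using Decomposition.inductionOn 𝒜 with
  | zero => simp
  | add x z hx hz => simp [hx, hz]
  | @homogeneous r x =>
    by_cases hr : r = p
    · subst hr
      rw [decompose_of_mem_same _ x.2]
    · rw [decompose_of_mem_ne _ x.2 hr, map_zero, LinearMap.zero_apply,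
        GradedLieAlgebra.killingForm_eq_zero 𝒜 (by omega) x.2 hy]

variable [CharZero K]

/-- The radical is the Killing orthogonal of [𝔤, 𝔤], and degree p pairs only with degree -p. -/
theorem GradedLieAlgebra.decompose_mem_radical {x : 𝔤} (hx : x ∈ radical K 𝔤) (p : ℤ) :
    (decompose 𝒜 x p : 𝔤) ∈ radical K 𝔤 := by
  rw [LieAlgebra.mem_radical_iff] at hx ⊢
  intro y z
  induction y using Decomposition.inductionOn 𝒜 with
  | zero => simp
  | add a b ha hb => rw [add_lie, map_add, ha, hb, add_zero]
  | @homogeneous i y =>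
  induction z using Decomposition.inductionOn 𝒜 with
  | zero => simp
  | add a b ha hb => rw [lie_add, map_add, ha, hb, add_zero]
  | @homogeneous j z =>
    have hm := GradedLieAlgebra.lie_mem y.2 z.2
    by_cases h : i + j = -p
    · rw [GradedLieAlgebra.killingForm_decompose 𝒜 (h ▸ hm), hx]
    · exact GradedLieAlgebra.killingForm_eq_zero 𝒜 (by omega) (decompose 𝒜 x p).2 hm

/-- The components of nonzero degree are ad-nilpotent elements of the radical. This gives rad 𝔤 =
(rad 𝔤 ∩ 𝔤₀) + 𝔫. -/
theorem GradedLieAlgebra.sub_decompose_mem_nilradicalIdeal {x : 𝔤} (hx : x ∈ radical K 𝔤) :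
    x - decompose 𝒜 x 0 ∈ nilradicalIdeal K 𝔤 := by
  classical
  have h : ∀ p ≠ 0, (decompose 𝒜 x p : 𝔤) ∈ nilradicalIdeal K 𝔤 := fun p hp ↦
    mem_nilradicalIdeal_of_mem_radical (GradedLieAlgebra.decompose_mem_radical 𝒜 hx p)
      (GradedLieAlgebra.isNilpotent_ad 𝒜 hp (decompose 𝒜 x p).2)
  have hs : ∑ p ∈ insert 0 (decompose 𝒜 x).support, (decompose 𝒜 x p : 𝔤) = x := by
    rw [Finset.sum_insert_of_eq_zero_if_notMem fun h0 ↦ by simpa using h0]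
    exact sum_support_decompose 𝒜 x
  rw [← Finset.add_sum_erase _ _ (Finset.mem_insert_self 0 _)] at hs
  rw [← eq_sub_of_add_eq' hs]
  exact sum_mem fun p hp ↦ h p (Finset.ne_of_mem_erase hp)

/-- Orthogonality to the other degrees is automatic, so x is Killing-orthogonal to all of 𝔤 and lies
in the radical. -/
theorem GradedLieAlgebra.mem_nilradicalIdeal {x : 𝔤} (hx : x ∈ 𝒜 0)
    (hn : _root_.IsNilpotent (ad K 𝔤 x)) (h0 : ∀ y ∈ 𝒜 0, killingForm K 𝔤 x y = 0) :
    x ∈ nilradicalIdeal K 𝔤 := by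
  have h : ∀ y, killingForm K 𝔤 x y = 0 := by
    intro y
    induction y using Decomposition.inductionOn 𝒜 with
    | zero => simp
    | add a b ha hb => rw [map_add, ha, hb, add_zero]
    | @homogeneous i y =>
      by_cases hi : i = 0
      · subst hi
        exact h0 y y.2
      · exact GradedLieAlgebra.killingForm_eq_zero 𝒜 (by omega) hx y.2
  exact mem_nilradicalIdeal_of_mem_radical (LieAlgebra.mem_radical_iff.2 fun y z ↦ h _) hn

end Graded

/-! ### The implications of the theorem. -/

section Main

attribute [local instance 100] LieRing.ofAssociativeRing

open LieModule LieAlgebra DirectSum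

variable {K 𝔤 : Type*} [Field K] [LieRing 𝔤] [LieAlgebra K 𝔤] {𝒜 : ℤ → Submodule K 𝔤}
  [GradedLieAlgebra 𝒜]

/-- A derivation of degree zero that vanishes on `𝔪` is zero. -/
theorem IsAlmostEffective.derivation_eq_zero (h𝒜 : IsAlmostEffective 𝒜) {N : Module.End K 𝔤}
    (hN : ∀ x y, N ⁅x, y⁆ = ⁅N x, y⁆ + ⁅x, N y⁆) (h0 : ∀ p, ∀ x ∈ 𝒜 p, N x ∈ 𝒜 p)
    (hm : ∀ p < 0, ∀ x ∈ 𝒜 p, N x = 0) : N = 0 := by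
  have key : ∀ n : ℕ, ∀ p : ℤ, p < n → ∀ x ∈ 𝒜 p, N x = 0 := by
    intro n
    induction n with
    | zero => exact hm
    | succ n ih =>
      intro p hp x hx
      by_cases hp0 : p < 0
      · exact hm p hp0 x hx
      -- For y in 𝔪 the Leibniz rule gives [N x, y] = N [x, y], which vanishes because [x, y] has
      -- lower degree.
      · refine h𝒜.eq_zero_of_mem (not_lt.1 hp0) (h0 p x hx) fun q hq y hy ↦ ?_
        have h1 := hN x y
        rwa [hm q hq y hy, lie_zero, add_zero,
          ih (p + q) (by push_cast at hp; omega) _ (GradedLieAlgebra.lie_mem hx hy), eq_comm] at h1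
  ext x
  induction x using Decomposition.inductionOn 𝒜 with
  | zero => simp
  | add a b ha hb => rw [map_add, ha, hb, map_add]
  | @homogeneous i x => exact key (i.toNat + 1) i (by push_cast; omega) x x.2

theorem mem_adjoin_ad_apply {z : 𝔤} (hz : z ∈ 𝒜 0) {N : Module.End K 𝔤}
    (hN : N ∈ Algebra.adjoin K {ad K 𝔤 z}) (p : ℤ) {x : 𝔤} (hx : x ∈ 𝒜 p) : N x ∈ 𝒜 p :=
  LinearMap.mem_of_mem_adjoin hN (fun _ hv ↦ GradedLieAlgebra.lie_mem_zero hz hv) hx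

variable [FiniteDimensional K 𝔤]

theorem IsSemisimpleLieModule.isOfReductiveType (h𝒜 : IsAlmostEffective 𝒜)
    (h : IsSemisimpleLieModule K (structureSubalgebra 𝒜) 𝔤) : IsOfReductiveType 𝒜 := by
  refine (Submodule.eq_bot_iff _).2 fun x hx ↦ ?_
  refine congrArg Subtype.val (h𝒜.eq_zero ⟨x, hx.2⟩ fun v ↦ Subtype.ext ?_)
  exact h.toEnd_eq_zero ((nilradicalIdeal K 𝔤).comap (structureSubalgebra 𝒜).incl)
    (fun y hy ↦ isNilpotent_ad_of_mem_nilradicalIdeal hy) hx.1 (v : 𝔤)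

variable [CharZero K]

theorem IsSemisimpleLieModule.of_negativePart (h𝒜 : IsAlmostEffective 𝒜)
    (h : IsSemisimpleLieModule K (structureSubalgebra 𝒜) (negativePart 𝒜)) :
    IsSemisimpleLieModule K (structureSubalgebra 𝒜) 𝔤 := by
  have hc : ∀ z ∈ radical K (structureSubalgebra 𝒜), ∀ y, ⁅y, z⁆ = 0 := fun z hz y ↦
    h𝒜.eq_zero _ fun v ↦ h.lie_radical_eq_zero hz y v
  refine LieModule.isSemisimple_of_radical (fun z hz ↦ ?_) fun z hz y v ↦ by
    rw [hc z hz, zero_lie]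
  change (ad K 𝔤 (z : 𝔤)).IsSemisimple
  have hs := h.isSemisimple_toEnd (x := z) fun y v ↦ by rw [hc z hz, zero_lie]
  obtain ⟨S, -, N, hN, hJ⟩ := IsJordanChevalley.exists_mem_adjoin (ad K 𝔤 (z : 𝔤))
  have hJ' : IsJordanChevalley (toEnd K (structureSubalgebra 𝒜) (negativePart 𝒜) z)
      (toEnd K (structureSubalgebra 𝒜) (negativePart 𝒜) z) 0 :=
    ⟨add_zero _, Commute.zero_right _, hs, IsNilpotent.zero⟩
  have hN0 : N = 0 := by
    refine h𝒜.derivation_eq_zero (hJ.nilpotent_leibniz fun x y ↦ leibniz_lie _ _ _)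
      (fun p x hx ↦ mem_adjoin_ad_apply z.2 hN p hx) fun p hp x hx ↦ ?_
    have := hJ'.nilpotent_comp hJ (f := (negativePart 𝒜).toSubmodule.subtype) (fun v ↦ rfl)
      ⟨x, mem_negativePart hp hx⟩
    rw [LinearMap.zero_apply, map_zero] at this
    exact this.symm
  rw [← hJ.add_eq, hN0, add_zero]
  exact hJ.semisimple

theorem IsSemisimpleLieModule.of_isDecomposable (hr : IsOfReductiveType 𝒜)
    (hd : IsDecomposableLieAlgebra K 𝔤) :
    IsSemisimpleLieModule K (structureSubalgebra 𝒜) 𝔤 := by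
  have hr0 : ∀ x ∈ 𝒜 0, x ∈ nilradicalIdeal K 𝔤 → x = 0 := fun x h0 hx ↦
    (Submodule.mem_bot K).1 (hr ▸ ⟨hx, h0⟩)
  have hc : ∀ z ∈ radical K (structureSubalgebra 𝒜), ∀ y, ⁅y, z⁆ = 0 := fun z hz y ↦ by
    set I := ⁅(⊤ : LieIdeal K (structureSubalgebra 𝒜)), radical K (structureSubalgebra 𝒜)⁆
    have := LieModule.isNilpotent_lie_solvable (V := 𝔤) (radical K (structureSubalgebra 𝒜))
    have hI : ⁅y, z⁆ ∈ I := LieSubmodule.lie_mem_lie trivial hz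
    refine Subtype.ext (hr0 _ ⁅y, z⁆.2 (GradedLieAlgebra.mem_nilradicalIdeal 𝒜 ⁅y, z⁆.2
      (LieModule.isNilpotent_toEnd_of_isNilpotent K I 𝔤 ⟨_, hI⟩) fun w hw ↦ ?_))
    exact (LinearMap.isNilpotent_trace_of_isNilpotent
      (LieIdeal.isNilpotent_toEnd_mul (V := 𝔤) I hI ⟨w, hw⟩)).eq_zero
  refine LieModule.isSemisimple_of_radical (fun z hz ↦ ?_) fun z hz y v ↦ by
    rw [hc z hz, zero_lie]
  change (ad K 𝔤 (z : 𝔤)).IsSemisimple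
  obtain ⟨S', -, N', hN', hJ'⟩ := IsJordanChevalley.exists_mem_adjoin (ad K 𝔤 (z : 𝔤))
  obtain ⟨S, -, N, ⟨y, hy⟩, hJ⟩ := hd (ad K 𝔤 (z : 𝔤)) ⟨(z : 𝔤), rfl⟩
  -- By uniqueness the inner component N is the one that is polynomial in ad z, so it preserves
  -- degrees.
  have hN : N ∈ Algebra.adjoin K {ad K 𝔤 (z : 𝔤)} := by
    convert hN'
    ext v
    exact hJ.nilpotent_comp hJ' (f := LinearMap.id) (fun _ ↦ rfl) v
  replace hy : ad K 𝔤 y = N := hy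
  have hy0 : ad K 𝔤 (decompose 𝒜 y 0 : 𝔤) = N := by
    ext x
    induction x using Decomposition.inductionOn 𝒜 with
    | zero => simp
    | add a b ha hb => rw [map_add, ha, hb, map_add]
    | @homogeneous p x =>
      have h1 := GradedLieAlgebra.decompose_lie 𝒜 x.2 y 0
      have h2 : ⁅y, (x : 𝔤)⁆ ∈ 𝒜 p := by
        have := mem_adjoin_ad_apply z.2 hN p x.2
        rwa [← hy] at this
      rw [zero_add, decompose_of_mem_same 𝒜 h2] at h1
      rw [← hy]
      exact h1.symm
  have h0 : (decompose 𝒜 y 0 : 𝔤) = 0 := by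
    refine hr0 _ (decompose 𝒜 y 0).2 (GradedLieAlgebra.mem_nilradicalIdeal 𝒜
      (decompose 𝒜 y 0).2 (hy0 ▸ hJ.nilpotent) fun w hw ↦ ?_)
    rw [killingForm_apply_apply, hy0]
    -- z is central in 𝔤₀, so 𝔤₀ commutes with N and (ad w) N is nilpotent, hence traceless.
    have hcomm : Commute (ad K 𝔤 w) N := by
      refine Algebra.commute_of_mem_adjoin_singleton_of_commute hN ?_
      rw [commute_iff_lie_eq, ← LieHom.map_lie,
        show ⁅w, (z : 𝔤)⁆ = 0 from congrArg Subtype.val (hc z hz ⟨w, hw⟩), map_zero]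
    exact (LinearMap.isNilpotent_trace_of_isNilpotent
      (hcomm.symm.isNilpotent_mul_right hJ.nilpotent)).eq_zero
  rw [← hJ.add_eq, ← hy0, h0, map_zero, add_zero]
  exact hJ.semisimple

theorem IsSemisimpleLieModule.isDecomposable (h𝒜 : IsAlmostEffective 𝒜)
    (h : IsSemisimpleLieModule K (structureSubalgebra 𝒜) 𝔤) : IsDecomposableLieAlgebra K 𝔤 := by
  set Z : LieIdeal K (structureSubalgebra 𝒜) :=
    (radical K 𝔤).comap (structureSubalgebra 𝒜).incl with hZ
  have hZs : IsSolvable Z :=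
    LieIdeal.isSolvable_of_le_comap (A := ⊥) (structureSubalgebra 𝒜).incl le_rfl fun x hx ↦
      (LieSubmodule.mem_bot x).2 (Subtype.ext hx.2)
  have hc : ∀ z ∈ Z, ∀ y, ⁅y, z⁆ = 0 := fun z hz y ↦ h𝒜.eq_zero _ fun v ↦
    Subtype.ext (h.lie_radical_eq_zero (LieAlgebra.mem_radical_of_mem hZs hz) y v)
  have hss : ∀ z ∈ Z, (ad K 𝔤 (z : 𝔤)).IsSemisimple := fun z hz ↦
    h.isSemisimple_toEnd (x := z) fun y v ↦ by rw [hc z hz, zero_lie]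
  have hn : ∀ x ∈ radical K 𝔤, ∀ y, ⁅x, y⁆ ∈ nilradicalIdeal K 𝔤 := fun x hx y ↦ by
    rw [← lie_skew]
    exact neg_mem (lie_radical_le_nilradicalIdeal (LieSubmodule.lie_mem_lie trivial hx))
  let c : LieSubalgebra K 𝔤 :=
    { carrier := {x | ∀ z ∈ Z, ⁅(z : 𝔤), x⁆ = 0}
      add_mem' := fun {a b} ha hb z hz ↦ by rw [lie_add, ha z hz, hb z hz, add_zero]
      zero_mem' := fun z _ ↦ lie_zero _
      smul_mem' := fun r a ha z hz ↦ by rw [lie_smul, ha z hz, smul_zero]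
      lie_mem' := fun {a b} ha hb z hz ↦ by
        rw [leibniz_lie, ha z hz, hb z hz, zero_lie, lie_zero, add_zero] }
  -- Z is abelian and acts semisimply, so 𝔤 is spanned by the Z-invariants and [Z, 𝔤] ⊆ 𝔫.
  have hcn : ∀ x, ∃ w ∈ c, x - w ∈ nilradicalIdeal K 𝔤 := by
    intro x
    have hab : ∀ y x : Z, ⁅y, x⁆ = 0 := fun y x ↦ Subtype.ext (hc x x.2 y)
    obtain ⟨w, hw, hxw⟩ := LieModule.exists_invariant_sub_mem (K := K) (L := Z) (V := 𝔤)
      (fun x _ ↦ hss x x.2) (fun x _ y v ↦ by rw [hab, zero_lie]) x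
    refine ⟨w, fun z hz ↦ hw ⟨z, hz⟩, ?_⟩
    rw [← LieSubmodule.mem_toSubmodule, LieSubmodule.lieIdeal_oper_eq_linear_span'] at hxw
    refine (Submodule.span_le (p := (nilradicalIdeal K 𝔤).toSubmodule)).2 ?_ hxw
    rintro _ ⟨z, -, v, -, rfl⟩
    exact hn _ z.2 v
  -- As 𝔤 = 𝔠 + 𝔫 and 𝔫 is in the kernel of the Killing form, orthogonality to [𝔠, 𝔠] suffices.
  have hrc : ∀ r ∈ radical K c, (r : 𝔤) ∈ radical K 𝔤 := by
    intro r hr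
    rw [LieAlgebra.mem_radical_iff]
    intro y z
    obtain ⟨y', hy', hy⟩ := hcn y
    obtain ⟨z', hz', hz⟩ := hcn z
    have h1 : ⁅y, z⁆ = ⁅y', z'⁆ + (⁅y - y', z⁆ + ⁅y', z - z'⁆) := by
      rw [sub_lie, lie_sub]; abel
    have h2 : ⁅y - y', z⁆ + ⁅y', z - z'⁆ ∈ nilradicalIdeal K 𝔤 :=
      add_mem (lie_mem_left K 𝔤 _ _ _ hy) (lie_mem_right K 𝔤 _ _ _ hz)
    rw [h1, map_add, killingForm_eq_zero_of_mem_nilradicalIdeal h2, add_zero]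
    exact LieModule.traceForm_lie_eq_zero_of_mem_radical 𝔤 hr ⟨y', hy'⟩ ⟨z', hz'⟩
  obtain ⟨S, hS, hSc⟩ := LieAlgebra.exists_levi (K := K) (L := c)
  rintro _ ⟨x, rfl⟩
  obtain ⟨w, hw, hxw⟩ := hcn x
  obtain ⟨s, hs, hsw⟩ := hSc ⟨w, hw⟩
  set r : 𝔤 := w - s
  have hr : r ∈ radical K 𝔤 := hrc _ hsw
  set z : structureSubalgebra 𝒜 := decompose 𝒜 r 0
  have hz : z ∈ Z := GradedLieAlgebra.decompose_mem_radical 𝒜 hr 0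
  have hrz : r - z ∈ nilradicalIdeal K 𝔤 :=
    GradedLieAlgebra.sub_decompose_mem_nilradicalIdeal 𝒜 hr
  obtain ⟨a, b, hab, hJ⟩ := LieAlgebra.exists_isJordanChevalley_toEnd (K := K) (L := S) 𝔤 ⟨s, hs⟩
  replace hab : ((a : c) : 𝔤) + ((b : c) : 𝔤) = s :=
    congrArg (fun s : S ↦ ((s : c) : 𝔤)) hab
  replace hJ : IsJordanChevalley (ad K 𝔤 (s : 𝔤)) (ad K 𝔤 ((a : c) : 𝔤))
    (ad K 𝔤 ((b : c) : 𝔤)) := hJ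
  have hac : ⁅(z : 𝔤), ((a : c) : 𝔤)⁆ = 0 := (a : c).2 z hz
  have hbc : ⁅(z : 𝔤), ((b : c) : 𝔤)⁆ = 0 := (b : c).2 z hz
  generalize ((a : c) : 𝔤) = a at hab hJ hac
  generalize ((b : c) : 𝔤) = b at hab hJ hbc
  -- Only ad a and ad b are known to commute; [a, b] is central in 𝔤, hence in 𝔫.
  have hlab : ⁅a, b⁆ ∈ nilradicalIdeal K 𝔤 := by
    have h1 : ad K 𝔤 ⁅a, b⁆ = 0 := by
      rw [LieHom.map_lie]
      exact commute_iff_lie_eq.1 hJ.commute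
    refine mem_nilradicalIdeal_of_mem_radical (LieAlgebra.mem_radical_iff.2 fun y v ↦ ?_)
      (h1 ▸ IsNilpotent.zero)
    rw [killingForm_apply_apply, h1, LinearMap.zero_comp, map_zero]
  -- Kb + 𝔫 is normalized by a + z, as z commutes with b and [a, b] is in 𝔫.
  let J : LieSubalgebra K 𝔤 :=
    { Submodule.span K {b} ⊔ (nilradicalIdeal K 𝔤).toSubmodule with
      lie_mem' := by
        intro x y hx hy
        change x ∈ Submodule.span K {b} ⊔ (nilradicalIdeal K 𝔤).toSubmodule at hx
        change y ∈ Submodule.span K {b} ⊔ (nilradicalIdeal K 𝔤).toSubmodule at hy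
        refine Submodule.mem_sup_right ?_
        obtain ⟨_, hx1, u, hu, rfl⟩ := Submodule.mem_sup.1 hx
        obtain ⟨p, rfl⟩ := Submodule.mem_span_singleton.1 hx1
        obtain ⟨_, hy1, v, hv, rfl⟩ := Submodule.mem_sup.1 hy
        obtain ⟨q, rfl⟩ := Submodule.mem_span_singleton.1 hy1
        rw [add_lie, lie_add, smul_lie, lie_smul, lie_self, smul_zero, smul_zero, zero_add]
        exact add_mem (lie_mem_right K 𝔤 _ _ _ hv) (lie_mem_left K 𝔤 _ _ _ hu) }
  have hJn : ∀ x ∈ J, _root_.IsNilpotent (ad K 𝔤 x) := by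
    intro x hx
    obtain ⟨_, hx1, u, hu, rfl⟩ := Submodule.mem_sup.1 hx
    obtain ⟨p, rfl⟩ := Submodule.mem_span_singleton.1 hx1
    rw [add_comm]
    refine LieIdeal.isNilpotent_toEnd_add (V := 𝔤) _ hu ?_
    rw [map_smul]
    exact hJ.nilpotent.smul p
  have ht : (ad K 𝔤 (a + z)).IsSemisimple := by
    rw [map_add]
    refine Module.End.IsSemisimple.add_of_commute ?_ hJ.semisimple (hss z hz)
    rw [commute_iff_lie_eq, ← LieHom.map_lie, ← lie_skew, hac, neg_zero, map_zero]
  have htJ : ∀ x ∈ J, ⁅a + z, x⁆ ∈ J := by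
    intro x hx
    obtain ⟨_, hx1, u, hu, rfl⟩ := Submodule.mem_sup.1 hx
    obtain ⟨p, rfl⟩ := Submodule.mem_span_singleton.1 hx1
    refine Submodule.mem_sup_right ?_
    rw [lie_add, lie_smul, add_lie, hbc, add_zero]
    exact add_mem (Submodule.smul_mem _ p hlab) (lie_mem_right K 𝔤 _ _ _ hu)
  have hv : b + ((x - w) + (r - z)) ∈ J :=
    Submodule.add_mem_sup (Submodule.mem_span_singleton_self b) (add_mem hxw hrz)
  obtain ⟨a', b', hJC⟩ := LieAlgebra.exists_isJordanChevalley_ad hJn ht htJ hv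
  have hx : a + z + (b + ((x - w) + (r - z))) = x := by
    have hr' : r = w - (a + b) := by rw [hab]
    rw [hr']
    abel
  rw [hx] at hJC
  exact ⟨_, ⟨a', rfl⟩, _, ⟨b', rfl⟩, hJC⟩

end Main

theorem mainTheorem6 {K 𝔤 : Type*} [Field K] [CharZero K] [LieRing 𝔤] [LieAlgebra K 𝔤]
    [FiniteDimensional K 𝔤] (𝒜 : ℤ → Submodule K 𝔤) [GradedLieAlgebra 𝒜]
    (h𝒜 : IsAlmostEffective 𝒜) :
    List.TFAE [
      IsDecomposableLieAlgebra K 𝔤 ∧ IsOfReductiveType 𝒜,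
      IsSemisimpleLieModule K (structureSubalgebra 𝒜) (negativePart 𝒜),
      IsSemisimpleLieModule K (structureSubalgebra 𝒜) 𝔤] := by
  tfae_have 1 → 3 := fun h ↦ IsSemisimpleLieModule.of_isDecomposable h.2 h.1
  tfae_have 3 → 2 := fun h ↦ h.lieSubmodule (negativePart 𝒜)
  tfae_have 2 → 3 := fun h ↦ IsSemisimpleLieModule.of_negativePart h𝒜 h
  tfae_have 3 → 1 := fun h ↦ ⟨h.isDecomposable h𝒜, h.isOfReductiveType h𝒜⟩
  tfae_finish
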